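/- Let $m\ge 0$ be an integer, let $A, C\in\mathbb C^{m\times m}$ be Hermitian and $B\in\mathbb C^{m\times m}$ arbitrary, and assume that the equation $BXB^*=C$ is consistent, i.e. has a solution $X\in\mathbb C^{m\times m}$. Write $r(\cdot)$ for the rank, $[P,\,Q]$ for the row block matrix, and $i_+(H)$, $i_-(H)$ for the numbers of positive and negative eigenvalues of a Hermitian matrix $H$, counted with multiplicity. For Hermitian $P,Q$ write $P\succcurlyeq Q$ (equivalently $Q\preccurlyeq P$) if $P-Q$ is positive semi-definite and $P\succ Q$ (equivalently $Q\prec P$) if $P-Q$ is positive definite. Put $$M_1=\begin{bmatrix} A & B\\ B^* & 0\end{bmatrix},\qquad M_2=\begin{bmatrix} BA & B^2\\ B^* & 0\end{bmatrix},\qquad M_3=BAB^*-BC-CB^*.$$ Then the following hold. (a) There exists a Hermitian $X\in\mathbb C^{m\times m}$ with $BX+XB^*\preccurlyeq A$ and $BXB^*=C$ if and only if $$r[\,B^2,\ C-BA\,]+i_-(M_1)-r(M_2)=0\quad\text{and}\quad r[\,B^2,\ C-BA\,]+i_-(M_3)-r[\,B^2,\ CB^*-BAB^*\,]=0.$$ (b)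 There exists a Hermitian $X\in\mathbb C^{m\times m}$ with $BX+XB^*\prec A$ and $BXB^*=C$ if and only if $$i_+(M_1)\ge m\quad\text{and}\quad i_+(M_3)=r(B).$$ (c) There exists a Hermitian $X\in\mathbb C^{m\times m}$ with $BX+XB^*\succcurlyeq A$ and $BXB^*=C$ if and only if $$r[\,B^2,\ C-BA\,]+i_+(M_1)-r(M_2)=0\quad\text{and}\quad r[\,B^2,\ C-BA\,]+i_+(M_3)-r[\,B^2,\ CB^*-BAB^*\,]=0.$$ (d) There exists a Hermitian $X\in\mathbb C^{m\times m}$ with $BX+XB^*\succ A$ and $BXB^*=C$ if and only if $$i_-(M_1)\ge m\quad\text{and}\quad i_-(M_3)=r(B).$$ -/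

import Mathlib

open scoped Matrix ComplexOrder

/-- `i₊(A)`: the number of positive eigenvalues, counted with multiplicity, of the Hermitian
matrix `A`. -/
noncomputable def posInertia {n : Type*} [Fintype n] [DecidableEq n] {A : Matrix n n ℂ}
    (hA : A.IsHermitian) : ℕ :=
  (Finset.univ.filter fun i => 0 < hA.eigenvalues i).card

/-- `i₋(A)`: the number of negative eigenvalues, counted with multiplicity, of the Hermitian
matrix `A`. -/
noncomputable def negInertia {n : Type*} [Fintype n] [DecidableEq n] {A : Matrix n n ℂ}
    (hA : A.IsHermitian) : ℕ :=
  (Finset.univ.filter fun i => hA.eigenvalues i < 0).card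

/-- The Löwner partial ordering `P ≽ Q`: the matrix `P - Q` is Hermitian positive
semi-definite. -/
def LoewnerGE {n : Type*} (P Q : Matrix n n ℂ) : Prop := (P - Q).PosSemidef

/-- The strict Löwner ordering `P ≻ Q`: the matrix `P - Q` is Hermitian positive definite. -/
def LoewnerGT {n : Type*} (P Q : Matrix n n ℂ) : Prop := (P - Q).PosDef

/-- The `2m × 2m` block matrix with rows `[A, B]` and `[B*, 0]`. -/
def blockM1 {m : ℕ} (A B : Matrix (Fin m) (Fin m) ℂ) :
    Matrix (Fin m ⊕ Fin m) (Fin m ⊕ Fin m) ℂ :=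
  Matrix.fromBlocks A B Bᴴ 0

/-- The `2m × 2m` block matrix with rows `[BA, B²]` and `[B*, 0]`. -/
def blockM2 {m : ℕ} (A B : Matrix (Fin m) (Fin m) ℂ) :
    Matrix (Fin m ⊕ Fin m) (Fin m ⊕ Fin m) ℂ :=
  Matrix.fromBlocks (B * A) (B ^ 2) Bᴴ 0

/-- The matrix `BAB* - BC - CB*`. -/
def matM3 {m : ℕ} (A B C : Matrix (Fin m) (Fin m) ℂ) : Matrix (Fin m) (Fin m) ℂ :=
  B * A * Bᴴ - B * C - C * Bᴴ

theorem blockM1_isHermitian {m : ℕ} {A : Matrix (Fin m) (Fin m) ℂ} (hA : A.IsHermitian)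
    (B : Matrix (Fin m) (Fin m) ℂ) : (blockM1 A B).IsHermitian := by
  unfold blockM1 Matrix.IsHermitian
  rw [Matrix.fromBlocks_conjTranspose, hA.eq]
  simp

theorem matM3_isHermitian {m : ℕ} {A C : Matrix (Fin m) (Fin m) ℂ} (hA : A.IsHermitian)
    (hC : C.IsHermitian) (B : Matrix (Fin m) (Fin m) ℂ) : (matM3 A B C).IsHermitian := by
  unfold matM3 Matrix.IsHermitian
  simp only [Matrix.conjTranspose_sub, Matrix.conjTranspose_mul,
    Matrix.conjTranspose_conjTranspose, hA.eq, hC.eq, Matrix.mul_assoc]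
  abel

/-! Fix a Hermitian solution `X₀` of `B X Bᴴ = C`; one exists because any solution can be averaged
with its adjoint. Put `G = A - (B X₀ + X₀ Bᴴ)`. The admissible corrections are the Hermitian `Y`
with `B Y Bᴴ = 0`, and the form of `B Y + Y Bᴴ` vanishes both on `ker Bᴴ` and on `range Bᴴ`. The
form of `G` on these two subspaces is therefore beyond control: on `ker Bᴴ` it is the form of `A`,
and at `Bᴴ x` it is the form of `M₃` at `x`. On the intersection the vector `G Bᴴ x = A Bᴴ x - C x`
is fixed as well.

Hence (a) requires nonnegativity on both subspaces, and a vector of the intersection that is null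
for the form must be killed by `G`. The semidefinite projection lemma
`IsHermitian.exists_posSemidef_sub` shows that these conditions suffice: a Schur complement splits
off the intersection, and every remaining cross term can be absorbed by some `B Y + Y Bᴴ`. The
strict case (b) follows by applying the semidefinite criterion to `A - η` for a small `η > 0`, which
compactness provides.

The rest is counting. Variational bounds show that `i₋(M₁)` is at least `r(B)`, with equality
exactly when `A` is nonnegative on `ker Bᴴ`. The block ranks are codimensions of explicit kernels.
So each left-hand side in (a) is a sum of two nonnegative integers, an inertia defect and a
difference of dimensions of nested subspaces, and it vanishes exactly when both do. Parts (c) and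
(d) follow from (a) and (b) through `(A, B) ↦ (-A, -B)`. -/

/-! ### Generalized inverses and adapted projections. -/

theorem LinearMap.exists_comp_comp_eq_self {K V W : Type*} [Field K] [AddCommGroup V] [Module K V]
    [AddCommGroup W] [Module K W] (f : V →ₗ[K] W) : ∃ g : W →ₗ[K] V, f ∘ₗ g ∘ₗ f = f := by
  obtain ⟨h, hh⟩ := f.rangeRestrict.exists_rightInverse_of_surjective f.range_rangeRestrict
  obtain ⟨g, hg⟩ := h.exists_extend
  refine ⟨g, LinearMap.ext fun x => ?_⟩
  have h1 : g (f x) = h (f.rangeRestrict x) := LinearMap.congr_fun hg (f.rangeRestrict x)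
  have h2 := congrArg Subtype.val (LinearMap.congr_fun hh (f.rangeRestrict x))
  simpa [h1] using h2

namespace Matrix

/-- Every matrix over a field has an inner generalized inverse. -/
theorem exists_mul_mul_eq_self {K m n : Type*} [Field K] [Fintype m] [Fintype n]
    (A : Matrix m n K) : ∃ Z : Matrix n m K, A * Z * A = A := by
  classical
  obtain ⟨g, hg⟩ := (toLin' A).exists_comp_comp_eq_self
  refine ⟨LinearMap.toMatrix' g, toLin'.injective ?_⟩
  rw [Matrix.mul_assoc, toLin'_mul, toLin'_mul, toLin'_toMatrix', hg]

/-- Normal equations: every complex matrix has a least squares generalized inverse. -/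
theorem exists_conjTranspose_mul_self_mul_eq {m n : Type*} [Fintype m] [Fintype n]
    (A : Matrix m n ℂ) : ∃ Z : Matrix n m ℂ, Aᴴ * A * Z = Aᴴ := by
  classical
  obtain ⟨Z, hZ⟩ := (Aᴴ * A).exists_mul_mul_eq_self
  refine ⟨Z * Aᴴ, ?_⟩
  have h : (Aᴴ * A * Z - 1) * (Aᴴ * A) = 0 := by rw [Matrix.sub_mul, hZ, Matrix.one_mul, sub_self]
  rw [mul_conjTranspose_mul_self_eq_zero, Matrix.sub_mul, Matrix.one_mul, sub_eq_zero] at h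
  rw [← Matrix.mul_assoc, h]

/-- Two subspaces and their intersection are simultaneously coordinate subspaces. -/
theorem _root_.Submodule.exists_adapted_projections {K V : Type*} [Field K] [AddCommGroup V]
    [Module K V] (U W : Submodule K V) : ∃ k u w : V →ₗ[K] V,
      (∀ x, k x ∈ U ⊓ W) ∧ (∀ x, u x ∈ U) ∧ (∀ x, w x ∈ W) ∧
      (∀ x ∈ U, w x = 0 ∧ k x + u x = x) ∧ (∀ x ∈ W, u x = 0 ∧ k x + w x = x) := by
  obtain ⟨L, hL⟩ := exists_isCompl (U ⊓ W)
  have hU : Disjoint (U ⊓ L) W := by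
    rw [disjoint_iff, inf_right_comm, hL.inf_eq_bot]
  have hW : Disjoint (W ⊓ L) U := by
    rw [disjoint_iff, inf_right_comm, inf_comm W U, hL.inf_eq_bot]
  -- The complement `U'` of `U ⊓ L` is taken to contain `W`, so that projecting along it kills `W`;
  -- likewise `W'` contains `U`.
  obtain ⟨U', hU', hcU⟩ := hU.symm.exists_isCompl
  obtain ⟨W', hW', hcW⟩ := hW.symm.exists_isCompl
  refine ⟨(U ⊓ W).projection L hL, (U ⊓ L).projection U' hcU.symm,
    (W ⊓ L).projection W' hcW.symm, Submodule.projection_apply_mem hL,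
    fun x => (Submodule.projection_apply_mem hcU.symm x).1,
    fun x => (Submodule.projection_apply_mem hcW.symm x).1, fun x hx => ?_, fun x hx => ?_⟩
  · refine ⟨Submodule.projection_apply_of_mem_right hcW.symm (hW' hx), ?_⟩
    have hk := Submodule.projection_apply_mem hL x
    have hr : x - (U ⊓ W).projection L hL x ∈ U ⊓ L :=
      ⟨U.sub_mem hx hk.1, Submodule.sub_projection_mem hL x⟩
    have h1 := Submodule.projection_apply_of_mem_left hcU.symm hr
    rw [map_sub, Submodule.projection_apply_of_mem_right hcU.symm (hU' hk.2), sub_zero] at h1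
    rw [h1, add_sub_cancel]
  · refine ⟨Submodule.projection_apply_of_mem_right hcU.symm (hU' hx), ?_⟩
    have hk := Submodule.projection_apply_mem hL x
    have hr : x - (U ⊓ W).projection L hL x ∈ W ⊓ L :=
      ⟨W.sub_mem hx hk.2, Submodule.sub_projection_mem hL x⟩
    have h1 := Submodule.projection_apply_of_mem_left hcW.symm hr
    rw [map_sub, Submodule.projection_apply_of_mem_right hcW.symm (hW' hk.1), sub_zero] at h1
    rw [h1, add_sub_cancel]

/-- Adapted projections for the kernel of `Bᴴ` and the range of `Bᴴ`, in matrix form. -/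
theorem exists_adapted_projections {n : Type*} [Fintype n] [DecidableEq n] (B : Matrix n n ℂ) :
    ∃ k k' u v v' : Matrix n n ℂ, k = Bᴴ * k' ∧ v = Bᴴ * v' ∧ Bᴴ * k = 0 ∧ Bᴴ * u = 0 ∧
      u * Bᴴ = 0 ∧ (k + v) * Bᴴ = Bᴴ ∧
      ∀ x : n → ℂ, Bᴴ *ᵥ x = 0 → v *ᵥ x = 0 ∧ k *ᵥ x + u *ᵥ x = x := by
  obtain ⟨k, u, v, hk, hu, hv, hU, hV⟩ :=
    Submodule.exists_adapted_projections (LinearMap.ker Bᴴ.mulVecLin)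
      (LinearMap.range Bᴴ.mulVecLin)
  obtain ⟨Z, hZ⟩ := Bᴴ.exists_mul_mul_eq_self
  have key : ∀ f : (n → ℂ) →ₗ[ℂ] n → ℂ, (∀ x, f x ∈ LinearMap.range Bᴴ.mulVecLin) →
      LinearMap.toMatrix' f = Bᴴ * (Z * LinearMap.toMatrix' f) := by
    intro f hf
    refine toLin'.injective (LinearMap.ext fun x => ?_)
    obtain ⟨y, hy⟩ := hf x
    rw [mulVecLin_apply] at hy
    rw [toLin'_apply, toLin'_apply, LinearMap.toMatrix'_mulVec, ← mulVec_mulVec, ← mulVec_mulVec,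
      LinearMap.toMatrix'_mulVec, ← hy, mulVec_mulVec, mulVec_mulVec, hZ]
  refine ⟨LinearMap.toMatrix' k, Z * LinearMap.toMatrix' k, LinearMap.toMatrix' u,
    LinearMap.toMatrix' v, Z * LinearMap.toMatrix' v, key k fun x => (hk x).2, key v hv,
    ?_, ?_, ?_, ?_, fun x hx => ?_⟩
  · refine toLin'.injective (LinearMap.ext fun x => ?_)
    simpa [← mulVec_mulVec, LinearMap.toMatrix'_mulVec] using (hk x).1
  · refine toLin'.injective (LinearMap.ext fun x => ?_)
    simpa [← mulVec_mulVec, LinearMap.toMatrix'_mulVec] using hu x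
  · refine toLin'.injective (LinearMap.ext fun x => ?_)
    simpa [← mulVec_mulVec, LinearMap.toMatrix'_mulVec] using (hV (Bᴴ *ᵥ x) ⟨x, rfl⟩).1
  · refine toLin'.injective (LinearMap.ext fun x => ?_)
    simpa [← mulVec_mulVec, LinearMap.toMatrix'_mulVec, add_mulVec] using
      (hV (Bᴴ *ᵥ x) ⟨x, rfl⟩).2
  · simpa [LinearMap.toMatrix'_mulVec] using hU x (by simpa using hx)

/-! ### The semidefinite projection lemma. -/

/-- If `S` has its columns in the range of `B` and kills the range of `Bᴴ`, then
`S + Sᴴ = B Y + Y Bᴴ` for a Hermitian `Y` with `B Y Bᴴ = 0`. -/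
theorem exists_isHermitian_mul_add_mul_eq {n : Type*} [Fintype n] [DecidableEq n]
    {B S : Matrix n n ℂ} (hS : ∀ x, Bᴴ *ᵥ x = 0 → Sᴴ *ᵥ x = 0) (hSB : S * Bᴴ = 0) :
    ∃ Y : Matrix n n ℂ, Y.IsHermitian ∧ B * Y * Bᴴ = 0 ∧ B * Y + Y * Bᴴ = S + Sᴴ := by
  obtain ⟨Z, hZ⟩ := Bᴴ.exists_mul_mul_eq_self
  obtain ⟨R', hR'⟩ := Bᴴ.exists_conjTranspose_mul_self_mul_eq
  rw [conjTranspose_conjTranspose] at hR'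
  have hM : S = B * (Zᴴ * S) := by
    have h : Sᴴ * (1 - Z * Bᴴ) = 0 := by
      refine toLin'.injective (LinearMap.ext fun x => ?_)
      rw [toLin'_apply, map_zero, LinearMap.zero_apply]
      have := hS ((1 - Z * Bᴴ) *ᵥ x) (by
        rw [mulVec_mulVec, Matrix.mul_sub, ← Matrix.mul_assoc, hZ, Matrix.mul_one, sub_self,
          zero_mulVec])
      rwa [mulVec_mulVec] at this
    have h' := congrArg Matrix.conjTranspose h
    simp only [conjTranspose_mul, conjTranspose_sub, conjTranspose_conjTranspose,
      conjTranspose_one, conjTranspose_zero, Matrix.sub_mul, Matrix.one_mul] at h'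
    rw [← Matrix.mul_assoc]
    exact sub_eq_zero.mp h'
  generalize Zᴴ * S = M at hM
  -- `F` is the orthogonal projection onto `ker B`. With `S = B M`, the choice `Y = M F + F Mᴴ`
  -- gives `B Y = S F = S`, because `B F = 0` and `S Bᴴ = 0`.
  set F : Matrix n n ℂ := 1 - Bᴴ * R' with hF
  have hSF : S * F = S := by
    rw [hF, Matrix.mul_sub, Matrix.mul_one, ← Matrix.mul_assoc, hSB, Matrix.zero_mul, sub_zero]
  have hBF : B * F = 0 := by
    rw [hF, Matrix.mul_sub, Matrix.mul_one, ← Matrix.mul_assoc, hR', sub_self]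
  have hRB : Bᴴ * R' = R'ᴴ * (B * Bᴴ) * R' := by
    have := congrArg Matrix.conjTranspose hR'
    simp only [conjTranspose_mul, conjTranspose_conjTranspose] at this
    nth_rewrite 1 [← this]
    rfl
  have hFh : Fᴴ = F := by
    rw [hF, conjTranspose_sub, conjTranspose_one, hRB]
    simp [conjTranspose_mul, Matrix.mul_assoc]
  have hBY : B * (M * F + F * Mᴴ) = S := by
    rw [Matrix.mul_add, ← Matrix.mul_assoc, ← Matrix.mul_assoc B F, hBF, Matrix.zero_mul, add_zero,
      ← hM, hSF]
  have hY : (M * F + F * Mᴴ).IsHermitian := by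
    simp [IsHermitian, conjTranspose_mul, hFh, add_comm]
  refine ⟨_, hY, by rw [hBY, hSB], ?_⟩
  have h := congrArg Matrix.conjTranspose hBY
  rw [conjTranspose_mul, hY.eq] at h
  rw [hBY, h]

theorem IsHermitian.posSemidef_conjTranspose_mul_mul {n : Type*} [Fintype n] {G : Matrix n n ℂ}
    (hG : G.IsHermitian) (M : Matrix n n ℂ)
    (h : ∀ x, 0 ≤ star (M *ᵥ x) ⬝ᵥ (G *ᵥ (M *ᵥ x))) : (Mᴴ * G * M).PosSemidef := by
  refine PosSemidef.of_dotProduct_mulVec_nonneg ?_ fun x => ?_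
  · simp [IsHermitian, conjTranspose_mul, hG.eq, Matrix.mul_assoc]
  · have := h x
    rwa [star_mulVec, ← dotProduct_mulVec, mulVec_mulVec, mulVec_mulVec] at this

/-- A semidefinite projection lemma: a Hermitian form which is nonnegative on the kernel and on the
range of `Bᴴ`, and whose null vectors in the intersection of both are in its radical, becomes
positive semidefinite after subtracting some `B Y + Y Bᴴ` with `Y` Hermitian and `B Y Bᴴ = 0`. -/
theorem IsHermitian.exists_posSemidef_sub {n : Type*} [Fintype n] [DecidableEq n]
    {G : Matrix n n ℂ} (hG : G.IsHermitian) (B : Matrix n n ℂ)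
    (hU : ∀ x, Bᴴ *ᵥ x = 0 → 0 ≤ star x ⬝ᵥ (G *ᵥ x))
    (hV : ∀ x, 0 ≤ star (Bᴴ *ᵥ x) ⬝ᵥ (G *ᵥ (Bᴴ *ᵥ x)))
    (hK : ∀ x, Bᴴ *ᵥ (Bᴴ *ᵥ x) = 0 → star (Bᴴ *ᵥ x) ⬝ᵥ (G *ᵥ (Bᴴ *ᵥ x)) = 0 →
      G *ᵥ (Bᴴ *ᵥ x) = 0) :
    ∃ Y : Matrix n n ℂ, Y.IsHermitian ∧ B * Y * Bᴴ = 0 ∧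
      (G - (B * Y + Y * Bᴴ)).PosSemidef := by
  obtain ⟨k, k', u, v, v', hk', hv', hBk, hBu, huB, hkvB, hvU⟩ := exists_adapted_projections B
  obtain ⟨Z, hZ⟩ := (kᴴ * G * k).exists_mul_mul_eq_self
  set P := kᴴ * G * k with hP
  have hPh : Pᴴ = P := by simp [hP, conjTranspose_mul, hG.eq, Matrix.mul_assoc]
  have hZ' : P * Zᴴ * P = P := by
    have := congrArg Matrix.conjTranspose hZ
    simpa [conjTranspose_mul, hPh, Matrix.mul_assoc] using this
  -- If `P y = 0`, then `k y` is a null vector of the form in the intersection, so `G k y = 0` by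
  -- `hK`. Thus `ker P ⊆ ker (G k)`, which is what a Schur complement with a merely generalized
  -- inverse of `P` needs.
  have key : ∀ Q : Matrix n n ℂ, P * Q * P = P → G * k * Q * P = G * k := by
    intro Q hQ
    suffices h : G * k * (1 - Q * P) = 0 by
      rw [Matrix.mul_sub, Matrix.mul_one, sub_eq_zero, ← Matrix.mul_assoc] at h
      exact h.symm
    refine toLin'.injective (LinearMap.ext fun x => ?_)
    rw [toLin'_apply, map_zero, LinearMap.zero_apply]
    set y := (1 - Q * P) *ᵥ x with hy
    have hPy : P *ᵥ y = 0 := by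
      rw [hy, mulVec_mulVec, Matrix.mul_sub, ← Matrix.mul_assoc, hQ, Matrix.mul_one, sub_self,
        zero_mulVec]
    have hky : Bᴴ *ᵥ (k' *ᵥ y) = k *ᵥ y := by rw [mulVec_mulVec, hk']
    have h1 := hK (k' *ᵥ y)
    rw [hky, mulVec_mulVec, hBk, zero_mulVec] at h1
    have h2 := h1 rfl (by
      rw [star_mulVec, ← dotProduct_mulVec, mulVec_mulVec, mulVec_mulVec, ← hP,
        hPy, dotProduct_zero])
    rwa [mulVec_mulVec, hy, mulVec_mulVec] at h2
  -- `T` acts as the `G`-orthogonal projection onto the range of `k`, up to the radical, and `L`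
  -- below is the corresponding Schur complement of `G`.
  set T := k * Z * kᴴ * G with hT
  set N := 1 - T with hN
  have hGNk : G * N * k = 0 := by
    have := key Z hZ
    simp only [hP, ← Matrix.mul_assoc] at this
    simp only [hN, hT, Matrix.mul_sub, Matrix.sub_mul, Matrix.mul_one, ← Matrix.mul_assoc]
    rw [this, sub_self]
  have hkGN : kᴴ * G * N = 0 := by
    have := congrArg Matrix.conjTranspose (key Zᴴ hZ')
    simp only [conjTranspose_mul, conjTranspose_conjTranspose, hG.eq, ← Matrix.mul_assoc, hP] at this
    simp only [hN, hT, Matrix.mul_sub, Matrix.mul_one, ← Matrix.mul_assoc]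
    rw [this, sub_self]
  have hTGN : Tᴴ * G * N = 0 := by
    simp only [hT, conjTranspose_mul, conjTranspose_conjTranspose, Matrix.mul_assoc]
    simp only [Matrix.mul_assoc] at hkGN
    simp [hkGN]
  have hNGT : Nᴴ * G * T = 0 := by
    have := congrArg Matrix.conjTranspose hTGN
    simpa [conjTranspose_mul, hG.eq, Matrix.mul_assoc] using this
  set L := Nᴴ * G * N with hL
  have hLh : Lᴴ = L := by simp [hL, conjTranspose_mul, hG.eq, Matrix.mul_assoc]
  have hsplit : G = Tᴴ * G * T + L := by
    have h1 : (T + N)ᴴ * G * (T + N) = G := by simp [hN]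
    rw [conjTranspose_add, Matrix.add_mul, Matrix.add_mul, Matrix.mul_add, Matrix.mul_add, hTGN,
      hNGT, add_zero, zero_add] at h1
    exact h1.symm
  have hLk : L * k = 0 := by
    rw [hL, Matrix.mul_assoc Nᴴ, Matrix.mul_assoc Nᴴ, hGNk, Matrix.mul_zero]
  have hkL : kᴴ * L = 0 := by
    have := congrArg Matrix.conjTranspose hLk
    simpa [conjTranspose_mul, hLh] using this
  set r := 1 - k - u - v with hr
  have hrB : r * Bᴴ = 0 := by
    rw [hr, Matrix.sub_mul, Matrix.sub_mul, Matrix.sub_mul, huB, Matrix.one_mul, sub_zero,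
      sub_sub, ← Matrix.add_mul, hkvB, sub_self]
  have hLexp : (u + v + r)ᴴ * L * (u + v + r) = L := by
    have h1 : u + v + r = 1 - k := by rw [hr]; abel
    rw [h1, Matrix.mul_sub, conjTranspose_sub, Matrix.sub_mul, Matrix.sub_mul, hkL,
      conjTranspose_one, Matrix.one_mul, Matrix.mul_one, sub_zero, hLk, Matrix.zero_mul, sub_zero, sub_zero]
  -- `S` takes one of each adjoint pair of cross terms, and half of the self-adjoint `r` term,
  -- oriented so that the left factor is `vᴴ` or `rᴴ` and the right factor is `u` or `r`. Since `v`
  -- and `r` kill `ker Bᴴ` while `u` and `r` kill `range Bᴴ`, both hypotheses of the absorption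
  -- lemma hold.
  set S := vᴴ * L * (u + r) + rᴴ * L * u + (1 / 2 : ℂ) • (rᴴ * L * r) with hS
  have hSS : S + Sᴴ = L - uᴴ * L * u - vᴴ * L * v := by
    suffices S + Sᴴ = (u + v + r)ᴴ * L * (u + v + r) - uᴴ * L * u - vᴴ * L * v by
      rw [this, hLexp]
    simp only [hS, conjTranspose_add, conjTranspose_mul, conjTranspose_smul,
      conjTranspose_conjTranspose, hLh, Matrix.mul_add, Matrix.add_mul, Matrix.mul_assoc]
    have : star (1 / 2 : ℂ) = 1 / 2 := by simp
    rw [this]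
    module
  obtain ⟨Y, hY, hBYB, hYS⟩ := exists_isHermitian_mul_add_mul_eq (B := B) (S := S)
    (fun x hx => by
      obtain ⟨h1, h2⟩ := hvU x hx
      have h3 : r *ᵥ x = 0 := by
        rw [hr, sub_mulVec, sub_mulVec, sub_mulVec, h1, one_mulVec, sub_zero, sub_sub, h2,
          sub_self]
      simp [hS, conjTranspose_add, conjTranspose_mul, add_mulVec, ← mulVec_mulVec, h1, h3,
        smul_mulVec])
    (by
      rw [hS, Matrix.add_mul, Matrix.add_mul, Matrix.mul_assoc, Matrix.add_mul, huB, hrB,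
        Matrix.mul_assoc _ u, huB, smul_mul_assoc, Matrix.mul_assoc _ r, hrB]
      simp)
  refine ⟨Y, hY, hBYB, ?_⟩
  -- After absorption only three congruences of `G` remain. The columns of `T` and `N u` lie in `ker
  -- Bᴴ`, those of `N v` in `range Bᴴ`.
  have hH : G - (B * Y + Y * Bᴴ) = Tᴴ * G * T + (N * u)ᴴ * G * (N * u) + (N * v)ᴴ * G * (N * v) := by
    rw [hYS, hSS]
    conv_lhs => rw [hsplit]
    simp only [hL, conjTranspose_mul, Matrix.mul_assoc]
    abel
  have hBT : Bᴴ * T = 0 := by simp only [hT, ← Matrix.mul_assoc, hBk, Matrix.zero_mul]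
  rw [hH]
  refine ((hG.posSemidef_conjTranspose_mul_mul _ fun x => hU _ ?_).add
    (hG.posSemidef_conjTranspose_mul_mul _ fun x => hU _ ?_)).add
    (hG.posSemidef_conjTranspose_mul_mul _ fun x => ?_)
  · rw [mulVec_mulVec, hBT, zero_mulVec]
  · rw [mulVec_mulVec, ← Matrix.mul_assoc, hN, Matrix.mul_sub, Matrix.mul_one, hBT, sub_zero, hBu,
      zero_mulVec]
  · have h1 : (N * v) *ᵥ x = Bᴴ *ᵥ ((v' - k' * Z * kᴴ * G * v) *ᵥ x) := by
      rw [mulVec_mulVec, hN, Matrix.sub_mul, Matrix.mul_sub, Matrix.one_mul, ← hv', hT]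
      conv_lhs => rw [hk']
      simp only [Matrix.mul_assoc]
      rw [← hk']
    rw [h1]
    exact hV _

end Matrix

/-! ### Inertia and dimensions of semidefinite subspaces. -/

namespace Matrix

variable {n : Type*} [Fintype n]

theorem dotProduct_mulVec_eq_sum_eigenvalues [DecidableEq n] {H : Matrix n n ℂ}
    (hH : H.IsHermitian) (x : n → ℂ) :
    (star x ⬝ᵥ (H *ᵥ x)).re = ∑ i, hH.eigenvalues i *
      Complex.normSq ((star (hH.eigenvectorUnitary : Matrix n n ℂ) *ᵥ x) i) := by
  conv_lhs => rw [hH.spectral_theorem, Unitary.conjStarAlgAut_apply]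
  rw [← mulVec_mulVec, ← mulVec_mulVec, dotProduct_mulVec,
    show star x ᵥ* (hH.eigenvectorUnitary : Matrix n n ℂ) =
      star (star (hH.eigenvectorUnitary : Matrix n n ℂ) *ᵥ x) by
        rw [star_mulVec, star_eq_conjTranspose, conjTranspose_conjTranspose],
    dotProduct, Complex.re_sum]
  refine Finset.sum_congr rfl fun i _ => ?_
  rw [mulVec_diagonal]
  simp [Complex.normSq_apply]
  ring

/-- The hypothesis says that `f` followed by restriction to the coordinates in `p` is injective. -/
theorem finrank_le_card_filter {W : Type*} [AddCommGroup W] [Module ℂ W] (f : W →ₗ[ℂ] n → ℂ)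
    (p : n → Prop) [DecidablePred p] (h : ∀ w, w ≠ 0 → ∃ i, p i ∧ f w i ≠ 0) :
    Module.finrank ℂ W ≤ (Finset.univ.filter p).card := by
  have hinj : Function.Injective (LinearMap.funLeft ℂ ℂ (Subtype.val : {i // p i} → n) ∘ₗ f) := by
    rw [← LinearMap.ker_eq_bot, LinearMap.ker_eq_bot']
    intro w hw
    by_contra hne
    obtain ⟨i, hi, hfi⟩ := h w hne
    exact hfi (congrFun hw ⟨i, hi⟩)
  have := LinearMap.finrank_le_finrank_of_injective hinj
  rwa [Module.finrank_pi, Fintype.card_subtype] at this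

theorem re_dotProduct_mulVec_smul (H : Matrix n n ℂ) (c : ℂ) (x : n → ℂ) :
    (star (c • x) ⬝ᵥ (H *ᵥ (c • x))).re = Complex.normSq c * (star x ⬝ᵥ (H *ᵥ x)).re := by
  rw [star_smul, mulVec_smul, dotProduct_smul, smul_dotProduct, smul_smul, smul_eq_mul,
    Complex.star_def, Complex.mul_conj, Complex.re_ofReal_mul]

theorem finrank_ker_mulVecLin_conjTranspose (B : Matrix n n ℂ) :
    B.rank + Module.finrank ℂ (LinearMap.ker Bᴴ.mulVecLin) = Fintype.card n := by
  rw [← rank_conjTranspose, rank, LinearMap.finrank_range_add_finrank_ker,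
    Module.finrank_fintype_fun_eq_card]

section Inertia

variable [DecidableEq n] {H : Matrix n n ℂ} {W : Type*} [AddCommGroup W] [Module ℂ W]

/-- In eigenvector coordinates, a vector whose coordinates at positive eigenvalues all vanish has a
nonpositive form value. Positivity of the form thus already makes `f` injective. -/
theorem finrank_le_posInertia (hH : H.IsHermitian) (f : W →ₗ[ℂ] n → ℂ)
    (hf : ∀ w, w ≠ 0 → 0 < (star (f w) ⬝ᵥ (H *ᵥ f w)).re) :
    Module.finrank ℂ W ≤ posInertia hH := by
  refine finrank_le_card_filter
    ((star (hH.eigenvectorUnitary : Matrix n n ℂ)).mulVecLin ∘ₗ f) _ fun w hw => ?_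
  by_contra! h
  refine (hf w hw).not_ge ?_
  rw [dotProduct_mulVec_eq_sum_eigenvalues hH]
  refine Finset.sum_nonpos fun i _ => ?_
  rcases le_or_gt (hH.eigenvalues i) 0 with hi | hi
  · exact mul_nonpos_of_nonpos_of_nonneg hi (Complex.normSq_nonneg _)
  · have := h i hi
    simp only [LinearMap.comp_apply, mulVecLin_apply] at this
    simp [this]

theorem finrank_le_negInertia (hH : H.IsHermitian) (f : W →ₗ[ℂ] n → ℂ)
    (hf : ∀ w, w ≠ 0 → (star (f w) ⬝ᵥ (H *ᵥ f w)).re < 0) :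
    Module.finrank ℂ W ≤ negInertia hH := by
  refine finrank_le_card_filter
    ((star (hH.eigenvectorUnitary : Matrix n n ℂ)).mulVecLin ∘ₗ f) _ fun w hw => ?_
  by_contra! h
  refine (hf w hw).not_ge ?_
  rw [dotProduct_mulVec_eq_sum_eigenvalues hH]
  refine Finset.sum_nonneg fun i _ => ?_
  rcases le_or_gt 0 (hH.eigenvalues i) with hi | hi
  · exact mul_nonneg hi (Complex.normSq_nonneg _)
  · have := h i hi
    simp only [LinearMap.comp_apply, mulVecLin_apply] at this
    simp [this]

/-- A nonzero vector supported on the negative eigenvalues has a negative form value, so `W` injects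
into the coordinates with nonnegative eigenvalue. Injectivity of `f` must be assumed, since the form
may vanish. -/
theorem finrank_add_negInertia_le (hH : H.IsHermitian) (f : W →ₗ[ℂ] n → ℂ)
    (hinj : Function.Injective f) (hf : ∀ w, 0 ≤ (star (f w) ⬝ᵥ (H *ᵥ f w)).re) :
    Module.finrank ℂ W + negInertia hH ≤ Fintype.card n := by
  have key : Module.finrank ℂ W ≤ (Finset.univ.filter fun i => ¬ hH.eigenvalues i < 0).card := by
    refine finrank_le_card_filter
      ((star (hH.eigenvectorUnitary : Matrix n n ℂ)).mulVecLin ∘ₗ f) _ fun w hw => ?_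
    by_contra! h
    simp only [LinearMap.comp_apply, mulVecLin_apply] at h
    have h0 : star (hH.eigenvectorUnitary : Matrix n n ℂ) *ᵥ f w = 0 := by
      by_contra hne
      obtain ⟨i, hi⟩ := Function.ne_iff.mp hne
      have hneg : hH.eigenvalues i < 0 := by
        by_contra hn
        exact hi (h i (not_lt.mp hn))
      refine (hf w).not_gt ?_
      rw [dotProduct_mulVec_eq_sum_eigenvalues hH]
      refine Finset.sum_neg' (fun j _ => ?_) ⟨i, Finset.mem_univ i,
        mul_neg_of_neg_of_pos hneg (Complex.normSq_pos.mpr hi)⟩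
      by_cases hj : hH.eigenvalues j < 0
      · exact mul_nonpos_of_nonpos_of_nonneg hj.le (Complex.normSq_nonneg _)
      · simp [h j (not_lt.mp hj)]
    have h1 : f w = 0 := by
      have := congrArg ((hH.eigenvectorUnitary : Matrix n n ℂ) *ᵥ ·) h0
      simpa [mulVec_mulVec] using this
    exact hw (hinj (by rw [h1, map_zero]))
  have := Finset.card_filter_add_card_filter_not (s := (Finset.univ : Finset n))
    (fun i => hH.eigenvalues i < 0)
  rw [Finset.card_univ] at this
  unfold negInertia
  omega

/-- The span of the eigenvectors whose index satisfies `p`, with the quadratic form on it. -/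
theorem exists_spectral_embedding (hH : H.IsHermitian) (p : n → Prop) [DecidablePred p] :
    ∃ f : ({i // p i} → ℂ) →ₗ[ℂ] n → ℂ, ∀ w, (star (f w) ⬝ᵥ (H *ᵥ f w)).re =
      ∑ i : {i // p i}, hH.eigenvalues i * Complex.normSq (w i) := by
  let e : ({i // p i} → ℂ) →ₗ[ℂ] n → ℂ := LinearMap.pi fun i =>
    if h : p i then LinearMap.proj ⟨i, h⟩ else 0
  refine ⟨(hH.eigenvectorUnitary : Matrix n n ℂ).mulVecLin ∘ₗ e, fun w => ?_⟩
  rw [dotProduct_mulVec_eq_sum_eigenvalues hH, LinearMap.comp_apply, mulVecLin_apply,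
    mulVec_mulVec, Unitary.coe_star_mul_self, one_mulVec,
    ← Finset.sum_subset (Finset.subset_univ (Finset.univ.filter p)) (fun i _ hi => by
      simp only [Finset.mem_filter, Finset.mem_univ, true_and] at hi
      simp [e, hi]),
    ← Finset.sum_subtype_of_mem (p := p) _ (fun i hi => (Finset.mem_filter.mp hi).2)]
  refine Finset.sum_congr (by ext i; simp [i.2]) fun i _ => ?_
  simp [e, i.2]

/-- The eigenvalue families of `H` and `-H` come from separate diagonalizations, so the counts are
compared through the definite subspaces they span. -/
theorem negInertia_neg (hH : H.IsHermitian) (hH' : (-H).IsHermitian) :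
    negInertia hH' = posInertia hH := by
  refine le_antisymm ?_ ?_
  · obtain ⟨f, hf⟩ := exists_spectral_embedding hH' fun i => hH'.eigenvalues i < 0
    have := finrank_le_posInertia hH f fun w hw => by
      have h := hf w
      rw [neg_mulVec, dotProduct_neg, Complex.neg_re, neg_eq_iff_eq_neg] at h
      rw [h, neg_pos]
      obtain ⟨i, hi⟩ := Function.ne_iff.mp hw
      exact Finset.sum_neg' (fun j _ => mul_nonpos_of_nonpos_of_nonneg j.2.le
        (Complex.normSq_nonneg _)) ⟨i, Finset.mem_univ i,
        mul_neg_of_neg_of_pos i.2 (Complex.normSq_pos.mpr hi)⟩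
    rwa [Module.finrank_pi, Fintype.card_subtype] at this
  · obtain ⟨f, hf⟩ := exists_spectral_embedding hH fun i => 0 < hH.eigenvalues i
    have := finrank_le_negInertia hH' f fun w hw => by
      rw [neg_mulVec, dotProduct_neg, Complex.neg_re, hf w, neg_lt_zero]
      obtain ⟨i, hi⟩ := Function.ne_iff.mp hw
      exact Finset.sum_pos' (fun j _ => mul_nonneg j.2.le (Complex.normSq_nonneg _))
        ⟨i, Finset.mem_univ i, mul_pos i.2 (Complex.normSq_pos.mpr hi)⟩
    rwa [Module.finrank_pi, Fintype.card_subtype] at this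

theorem negInertia_eq_zero_iff (hH : H.IsHermitian) :
    negInertia hH = 0 ↔ ∀ x, 0 ≤ (star x ⬝ᵥ (H *ᵥ x)).re := by
  refine ⟨fun h x => ?_, fun h => ?_⟩
  · by_contra! hx
    have := finrank_le_negInertia hH (LinearMap.toSpanSingleton ℂ _ x) fun c hc => by
      rw [LinearMap.toSpanSingleton_apply, re_dotProduct_mulVec_smul]
      exact mul_neg_of_pos_of_neg (Complex.normSq_pos.mpr hc) hx
    rw [Module.finrank_self] at this
    omega
  · have := finrank_add_negInertia_le hH LinearMap.id Function.injective_id h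
    rw [Module.finrank_fintype_fun_eq_card] at this
    omega

/-- The form descends to the quotient by `ker Bᴴ`, of dimension `r(B)`; maximal negative inertia
means negative definiteness there. -/
theorem negInertia_eq_rank_iff (hH : H.IsHermitian) (B : Matrix n n ℂ)
    (hHB : ∀ x, Bᴴ *ᵥ x = 0 → H *ᵥ x = 0) :
    negInertia hH = B.rank ↔ ∀ x, Bᴴ *ᵥ x ≠ 0 → (star x ⬝ᵥ (H *ᵥ x)).re < 0 := by
  have hdim := finrank_ker_mulVecLin_conjTranspose B
  refine ⟨fun h x hx => ?_, fun h => le_antisymm ?_ ?_⟩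
  · by_contra! hq
    -- If the form is nonnegative at some `x` outside `ker Bᴴ`, it is nonnegative on `ker Bᴴ ⊕ ℂ x`,
    -- a subspace one dimension too large.
    have := finrank_add_negInertia_le hH
      ((LinearMap.ker Bᴴ.mulVecLin).subtype.coprod (LinearMap.toSpanSingleton ℂ _ x))
      (by
        rw [← LinearMap.ker_eq_bot, LinearMap.ker_eq_bot']
        rintro ⟨⟨k, hk⟩, c⟩ hkc
        simp only [LinearMap.coprod_apply, Submodule.subtype_apply,
          LinearMap.toSpanSingleton_apply] at hkc
        have h1 := congrArg (Bᴴ *ᵥ ·) hkc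
        have hk' : Bᴴ *ᵥ k = 0 := hk
        simp only [mulVec_add, hk', mulVec_smul, zero_add, mulVec_zero, smul_eq_zero, hx,
          or_false] at h1
        subst h1
        simpa using hkc)
      (by
        rintro ⟨⟨k, hk⟩, c⟩
        have hk' := hHB k hk
        simp only [LinearMap.coprod_apply, Submodule.subtype_apply,
          LinearMap.toSpanSingleton_apply]
        have h2 : star k ⬝ᵥ (H *ᵥ (c • x)) = 0 := by
          rw [dotProduct_mulVec, ← hH.eq, ← star_mulVec, hk', star_zero, zero_dotProduct]
        rw [mulVec_add, hk', zero_add, star_add, add_dotProduct, h2, zero_add,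
          re_dotProduct_mulVec_smul]
        exact mul_nonneg (Complex.normSq_nonneg _) hq)
    rw [Module.finrank_prod, Module.finrank_self] at this
    omega
  · have := finrank_add_negInertia_le hH (LinearMap.ker Bᴴ.mulVecLin).subtype
      (Submodule.subtype_injective _) fun w => by
        rw [Submodule.subtype_apply, hHB w w.2, dotProduct_zero, Complex.zero_re]
    omega
  · obtain ⟨L, hL⟩ := exists_isCompl (LinearMap.ker Bᴴ.mulVecLin)
    have := finrank_le_negInertia hH L.subtype fun w hw => h w fun hw' => hw <| by
      have : (w : n → ℂ) ∈ LinearMap.ker Bᴴ.mulVecLin ⊓ L := ⟨hw', w.2⟩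
      rw [hL.inf_eq_bot] at this
      exact Subtype.ext this
    have hc := Submodule.finrank_add_eq_of_isCompl hL
    rw [Module.finrank_fintype_fun_eq_card] at hc
    omega

end Inertia

/-! ### Inertia of the bordered matrix `M₁`. -/

section Bordered

variable {m : ℕ} {A B : Matrix (Fin m) (Fin m) ℂ}

theorem re_dotProduct_blockM1_mulVec (A B : Matrix (Fin m) (Fin m) ℂ) (x y : Fin m → ℂ) :
    (star (Sum.elim x y) ⬝ᵥ (blockM1 A B *ᵥ Sum.elim x y)).re =
      (star x ⬝ᵥ (A *ᵥ x)).re + 2 * (star (Bᴴ *ᵥ x) ⬝ᵥ y).re := by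
  have h : star y ⬝ᵥ (Bᴴ *ᵥ x) = star (star (Bᴴ *ᵥ x) ⬝ᵥ y) :=
    star_dotProduct _ _
  rw [blockM1, fromBlocks_mulVec, Function.star_sumElim, sumElim_dotProduct_sumElim]
  simp only [Sum.elim_comp_inl, Sum.elim_comp_inr, zero_mulVec, add_zero, dotProduct_add, h,
    Complex.add_re, star_mulVec, conjTranspose_conjTranspose, ← dotProduct_mulVec,
    Complex.star_def, Complex.conj_re]
  ring

/-- The free second component lets every direction of `range B` contribute a negative square next to
those coming from `W`. -/
theorem rank_add_finrank_le_negInertia_blockM1 (hA : A.IsHermitian) {W : Type*} [AddCommGroup W]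
    [Module ℂ W] [FiniteDimensional ℂ W] (f : W →ₗ[ℂ] Fin m → ℂ) (hB : ∀ w, Bᴴ *ᵥ f w = 0)
    (hf : ∀ w, w ≠ 0 → (star (f w) ⬝ᵥ (A *ᵥ f w)).re < 0) :
    B.rank + Module.finrank ℂ W ≤ negInertia (blockM1_isHermitian hA B) := by
  obtain ⟨R, hR⟩ := B.exists_conjTranspose_mul_self_mul_eq
  -- For `z` in `range B` one has `⟨Bᴴ z, R v⟩ = ⟨z, v⟩`. The second component is chosen to cancel
  -- the `z`-`z` and `z`-`t` terms of `A` and to leave `-⟨z, z⟩`, so the form takes the value `⟨t, A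
  -- t⟩ - ⟨z, z⟩`; this explains the factor `1 / 2` and the summand `1`.
  let P : Matrix (Fin m) (Fin m) ℂ := -(R * ((1 / 2 : ℂ) • (A + 1)))
  let g : (LinearMap.range B.mulVecLin × W) →ₗ[ℂ] (Fin m ⊕ Fin m → ℂ) :=
    { toFun := fun p => Sum.elim (p.1 + f p.2) (P *ᵥ (p.1 : Fin m → ℂ) - (R * A) *ᵥ f p.2)
      map_add' := fun p q => by
        ext (i | i)
        · simp; ring
        · simp [mulVec_add]; ring
      map_smul' := fun c p => by
        ext (i | i)
        · simp [mul_add]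
        · simp [mulVec_smul, mul_sub] }
  have hg := finrank_le_negInertia (blockM1_isHermitian hA B) g fun p hp => by
    obtain ⟨⟨z, z', hz⟩, w⟩ := p
    rw [mulVecLin_apply] at hz
    have ht := hB w
    change (star (Sum.elim (z + f w) (P *ᵥ z - (R * A) *ᵥ f w)) ⬝ᵥ (blockM1 A B *ᵥ
      Sum.elim (z + f w) (P *ᵥ z - (R * A) *ᵥ f w))).re < 0
    have hw := hf w
    have ht0 : w = 0 → f w = 0 := fun h => by rw [h, map_zero]
    generalize f w = t at ht hw ht0
    have hzB : ∀ v, star (Bᴴ *ᵥ z) ⬝ᵥ (R *ᵥ v) = star z ⬝ᵥ v := by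
      intro v
      rw [star_mulVec, conjTranspose_conjTranspose, ← dotProduct_mulVec, ← hz, star_mulVec,
        ← dotProduct_mulVec, mulVec_mulVec, mulVec_mulVec, hR, dotProduct_mulVec]
    have hsym : (star t ⬝ᵥ (A *ᵥ z)).re = (star z ⬝ᵥ (A *ᵥ t)).re := by
      have : star t ⬝ᵥ (A *ᵥ z) = star (star z ⬝ᵥ (A *ᵥ t)) := by
        rw [star_dotProduct, star_mulVec, hA.eq, dotProduct_mulVec]
      rw [this, Complex.star_def, Complex.conj_re]
    have hval : (star (Sum.elim (z + t) (P *ᵥ z - (R * A) *ᵥ t)) ⬝ᵥ (blockM1 A B *ᵥ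
        Sum.elim (z + t) (P *ᵥ z - (R * A) *ᵥ t))).re =
        (star t ⬝ᵥ (A *ᵥ t)).re - (star z ⬝ᵥ z).re := by
      rw [re_dotProduct_blockM1_mulVec, mulVec_add Bᴴ, ht, add_zero, dotProduct_sub,
        ← mulVec_mulVec, hzB, neg_mulVec, dotProduct_neg, ← mulVec_mulVec, hzB, smul_mulVec,
        add_mulVec, one_mulVec, dotProduct_smul, dotProduct_add, star_add, mulVec_add]
      simp only [add_dotProduct, dotProduct_add, Complex.add_re, Complex.sub_re, Complex.neg_re,
        hsym, smul_eq_mul, Complex.mul_re]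
      norm_num
      ring
    rw [hval, sub_neg]
    have hz0 : 0 ≤ (star z ⬝ᵥ z).re := (Complex.le_def.mp (dotProduct_star_self_nonneg z)).1
    by_cases hw0 : w = 0
    · have hzne : z ≠ 0 := by
        rintro rfl
        exact hp (Prod.ext rfl hw0)
      rw [ht0 hw0, star_zero, zero_dotProduct, Complex.zero_re]
      exact (Complex.lt_def.mp (dotProduct_star_self_pos_iff.mpr hzne)).1
    · exact (hw hw0).trans_le hz0
  rwa [Module.finrank_prod] at hg

/-- On `f(W) × ℂᵐ` the cross term vanishes, so the form is nonnegative on a subspace of dimension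
`dim W + m` in `ℂ²ᵐ`. -/
theorem negInertia_blockM1_add_finrank_le (hA : A.IsHermitian) {W : Type*} [AddCommGroup W]
    [Module ℂ W] [FiniteDimensional ℂ W] (f : W →ₗ[ℂ] Fin m → ℂ) (hinj : Function.Injective f)
    (hB : ∀ w, Bᴴ *ᵥ f w = 0) (hf : ∀ w, 0 ≤ (star (f w) ⬝ᵥ (A *ᵥ f w)).re) :
    Module.finrank ℂ W + negInertia (blockM1_isHermitian hA B) ≤ m := by
  let g : (W × (Fin m → ℂ)) →ₗ[ℂ] (Fin m ⊕ Fin m → ℂ) :=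
    { toFun := fun p => Sum.elim (f p.1) p.2
      map_add' := fun p q => by ext (i | i) <;> simp
      map_smul' := fun c p => by ext (i | i) <;> simp }
  have hg := finrank_add_negInertia_le (blockM1_isHermitian hA B) g
    (fun p q h => Prod.ext (hinj (funext fun i => congrFun h (Sum.inl i)))
      (funext fun i => congrFun h (Sum.inr i)))
    (fun p => by
      change 0 ≤ (star (Sum.elim (f p.1) p.2) ⬝ᵥ (blockM1 A B *ᵥ Sum.elim (f p.1) p.2)).re
      rw [re_dotProduct_blockM1_mulVec, hB, star_zero, zero_dotProduct, Complex.zero_re, mul_zero,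
        add_zero]
      exact hf p.1)
  rw [Module.finrank_prod, Module.finrank_fintype_fun_eq_card, Fintype.card_sum,
    Fintype.card_fin] at hg
  omega

theorem rank_le_negInertia_blockM1 (hA : A.IsHermitian) (B : Matrix (Fin m) (Fin m) ℂ) :
    B.rank ≤ negInertia (blockM1_isHermitian hA B) := by
  have := rank_add_finrank_le_negInertia_blockM1 (B := B) hA
    (0 : (Fin 0 → ℂ) →ₗ[ℂ] Fin m → ℂ) (by simp) (fun w hw => absurd (Subsingleton.elim _ _) hw)
  omega

theorem negInertia_blockM1_le_rank_iff (hA : A.IsHermitian) (B : Matrix (Fin m) (Fin m) ℂ) :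
    negInertia (blockM1_isHermitian hA B) ≤ B.rank ↔
      ∀ x, Bᴴ *ᵥ x = 0 → 0 ≤ (star x ⬝ᵥ (A *ᵥ x)).re := by
  refine ⟨fun h x hx => ?_, fun h => ?_⟩
  · by_contra! hq
    have := rank_add_finrank_le_negInertia_blockM1 (B := B) hA (LinearMap.toSpanSingleton ℂ _ x)
      (fun c => by rw [LinearMap.toSpanSingleton_apply, mulVec_smul, hx, smul_zero])
      (fun c hc => by
        rw [LinearMap.toSpanSingleton_apply, re_dotProduct_mulVec_smul]
        exact mul_neg_of_pos_of_neg (Complex.normSq_pos.mpr hc) hq)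
    rw [Module.finrank_self] at this
    omega
  · have := negInertia_blockM1_add_finrank_le (B := B) hA (LinearMap.ker Bᴴ.mulVecLin).subtype
      (Submodule.subtype_injective _) (fun w => w.2) (fun w => h w w.2)
    have hdim := finrank_ker_mulVecLin_conjTranspose B
    rw [Fintype.card_fin] at hdim
    omega

theorem le_negInertia_blockM1_iff (hA : A.IsHermitian) (B : Matrix (Fin m) (Fin m) ℂ) :
    m ≤ negInertia (blockM1_isHermitian hA B) ↔
      ∀ x, x ≠ 0 → Bᴴ *ᵥ x = 0 → (star x ⬝ᵥ (A *ᵥ x)).re < 0 := by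
  refine ⟨fun h x hx0 hx => ?_, fun h => ?_⟩
  · by_contra! hq
    have := negInertia_blockM1_add_finrank_le (B := B) hA (LinearMap.toSpanSingleton ℂ _ x)
      (fun a b hab => smul_left_injective ℂ hx0 hab)
      (fun c => by rw [LinearMap.toSpanSingleton_apply, mulVec_smul, hx, smul_zero])
      (fun c => by
        rw [LinearMap.toSpanSingleton_apply, re_dotProduct_mulVec_smul]
        exact mul_nonneg (Complex.normSq_nonneg _) hq)
    rw [Module.finrank_self] at this
    omega
  · have := rank_add_finrank_le_negInertia_blockM1 (B := B) hA
      (LinearMap.ker Bᴴ.mulVecLin).subtype (fun w => w.2)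
      (fun w hw => h w (fun h0 => hw (Subtype.ext h0)) w.2)
    have hdim := finrank_ker_mulVecLin_conjTranspose B
    rw [Fintype.card_fin] at hdim
    omega

end Bordered
end Matrix

/-! ### Solvability in terms of quadratic forms. -/

namespace Matrix

section Existence

variable {n : Type*} [Fintype n]

theorem IsHermitian.dotProduct_mulVec_nonneg_iff {H : Matrix n n ℂ} (hH : H.IsHermitian)
    (x : n → ℂ) : 0 ≤ star x ⬝ᵥ (H *ᵥ x) ↔ 0 ≤ (star x ⬝ᵥ (H *ᵥ x)).re := by
  rw [Complex.le_def, Complex.zero_re, Complex.zero_im]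
  exact and_iff_left (hH.im_star_dotProduct_mulVec_self x).symm

theorem IsHermitian.dotProduct_mulVec_pos_iff {H : Matrix n n ℂ} (hH : H.IsHermitian)
    (x : n → ℂ) : 0 < star x ⬝ᵥ (H *ᵥ x) ↔ 0 < (star x ⬝ᵥ (H *ᵥ x)).re := by
  rw [Complex.lt_def, Complex.zero_re, Complex.zero_im]
  exact and_iff_left (hH.im_star_dotProduct_mulVec_self x).symm

theorem exists_isHermitian_of_mul_mul_conjTranspose_eq {B C : Matrix n n ℂ} (hC : C.IsHermitian)
    (h : ∃ X : Matrix n n ℂ, B * X * Bᴴ = C) :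
    ∃ X : Matrix n n ℂ, X.IsHermitian ∧ B * X * Bᴴ = C := by
  obtain ⟨X, hX⟩ := h
  refine ⟨(1 / 2 : ℂ) • (X + Xᴴ), ?_, ?_⟩
  · simp [IsHermitian, add_comm]
  · have h' : B * Xᴴ * Bᴴ = C := by
      have := congrArg Matrix.conjTranspose hX
      rwa [hC.eq, conjTranspose_mul, conjTranspose_mul, conjTranspose_conjTranspose,
        ← Matrix.mul_assoc] at this
    rw [Matrix.mul_smul, Matrix.smul_mul, Matrix.mul_add, Matrix.add_mul, hX, h']
    module

/-- A form which is positive on a subspace is uniformly positive there. -/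
theorem exists_pos_mul_le_of_pos_on (H : Matrix n n ℂ) (S : Submodule ℂ (n → ℂ))
    (h : ∀ x ∈ S, x ≠ 0 → 0 < (star x ⬝ᵥ (H *ᵥ x)).re) :
    ∃ ε : ℝ, 0 < ε ∧ ∀ x ∈ S, ε * (star x ⬝ᵥ x).re ≤ (star x ⬝ᵥ (H *ᵥ x)).re := by
  classical
  have hp : ∀ x : n → ℂ, x ≠ 0 → 0 < (star x ⬝ᵥ x).re := fun x hx =>
    (Complex.lt_def.mp (dotProduct_star_self_pos_iff.mpr hx)).1
  have hne : ∀ x ∈ (S : Set (n → ℂ)) ∩ Metric.sphere 0 1, x ≠ 0 := by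
    rintro x ⟨_, hx⟩ rfl
    simp at hx
  have hK : IsCompact ((S : Set (n → ℂ)) ∩ Metric.sphere 0 1) :=
    (isCompact_sphere 0 1).inter_left S.closed_of_finiteDimensional
  have hscale : ∀ x ∈ S, x ≠ 0 → ∃ y ∈ (S : Set (n → ℂ)) ∩ Metric.sphere 0 1, ∃ c : ℂ, x = c • y := by
    intro x hx hx0
    refine ⟨((‖x‖⁻¹ : ℝ) : ℂ) • x, ⟨S.smul_mem _ hx, ?_⟩, (‖x‖ : ℂ), ?_⟩
    · simp [norm_smul, hx0]
    · rw [smul_smul, ← Complex.ofReal_mul, mul_inv_cancel₀ (norm_ne_zero_iff.mpr hx0)]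
      simp
  rcases ((S : Set (n → ℂ)) ∩ Metric.sphere 0 1).eq_empty_or_nonempty with hem | hnem
  · refine ⟨1, one_pos, fun x hx => ?_⟩
    by_cases hx0 : x = 0
    · simp [hx0]
    · obtain ⟨y, hy, -⟩ := hscale x hx hx0
      rw [hem] at hy
      exact hy.elim
  -- The sphere is that of the sup norm, so the quotient by `⟨x, x⟩` is minimized rather than the
  -- form itself.
  · have hcont : ContinuousOn (fun x : n → ℂ => (star x ⬝ᵥ (H *ᵥ x)).re / (star x ⬝ᵥ x).re)
        ((S : Set (n → ℂ)) ∩ Metric.sphere 0 1) := by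
      refine ContinuousOn.div ?_ ?_ fun x hx => (hp x (hne x hx)).ne'
      · exact (Complex.continuous_re.comp
          (Continuous.dotProduct continuous_star (by fun_prop))).continuousOn
      · exact (Complex.continuous_re.comp
          (Continuous.dotProduct continuous_star continuous_id)).continuousOn
    obtain ⟨x₀, hx₀, hmin⟩ := hK.exists_isMinOn hnem hcont
    refine ⟨_, div_pos (h x₀ hx₀.1 (hne x₀ hx₀)) (hp x₀ (hne x₀ hx₀)), fun x hx => ?_⟩
    by_cases hx0 : x = 0
    · simp [hx0]
    · obtain ⟨y, hy, c, rfl⟩ := hscale x hx hx0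
      have h1 := (le_div_iff₀ (hp y (hne y hy))).mp (hmin hy)
      have h2 := re_dotProduct_mulVec_smul 1 c y
      rw [one_mulVec, one_mulVec] at h2
      rw [re_dotProduct_mulVec_smul, h2, mul_left_comm]
      exact mul_le_mul_of_nonneg_left h1 (Complex.normSq_nonneg c)

end Existence

section Equation

variable {m : ℕ} {A B C : Matrix (Fin m) (Fin m) ℂ}

theorem matM3_eq {X : Matrix (Fin m) (Fin m) ℂ} (hX : B * X * Bᴴ = C) :
    matM3 A B C = B * (A - (B * X + X * Bᴴ)) * Bᴴ := by
  rw [matM3, ← hX]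
  noncomm_ring

theorem dotProduct_matM3_mulVec {X : Matrix (Fin m) (Fin m) ℂ} (hX : B * X * Bᴴ = C)
    (x : Fin m → ℂ) : star x ⬝ᵥ (matM3 A B C *ᵥ x) =
      star (Bᴴ *ᵥ x) ⬝ᵥ ((A - (B * X + X * Bᴴ)) *ᵥ (Bᴴ *ᵥ x)) := by
  rw [matM3_eq hX, star_mulVec, conjTranspose_conjTranspose, ← dotProduct_mulVec, mulVec_mulVec,
    mulVec_mulVec, Matrix.mul_assoc]

/-- On the kernel of `Bᴴ`, subtracting `B X + X Bᴴ` does not change a Hermitian form. -/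
theorem dotProduct_sub_mulVec_of_mem_ker (A X : Matrix (Fin m) (Fin m) ℂ) {x : Fin m → ℂ}
    (hx : Bᴴ *ᵥ x = 0) :
    star x ⬝ᵥ ((A - (B * X + X * Bᴴ)) *ᵥ x) = star x ⬝ᵥ (A *ᵥ x) := by
  have h : star x ⬝ᵥ (B *ᵥ (X *ᵥ x)) = 0 := by
    rw [dotProduct_mulVec, ← conjTranspose_conjTranspose B, ← star_mulVec, hx, star_zero,
      zero_dotProduct]
  rw [sub_mulVec, add_mulVec, ← mulVec_mulVec, ← mulVec_mulVec, hx, mulVec_zero, add_zero,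
    dotProduct_sub, h, sub_zero]

theorem sub_mulVec_mulVec_eq {X : Matrix (Fin m) (Fin m) ℂ} (hX : B * X * Bᴴ = C) {x : Fin m → ℂ}
    (hx : Bᴴ *ᵥ (Bᴴ *ᵥ x) = 0) :
    (A - (B * X + X * Bᴴ)) *ᵥ (Bᴴ *ᵥ x) = A *ᵥ (Bᴴ *ᵥ x) - C *ᵥ x := by
  rw [sub_mulVec, add_mulVec, ← mulVec_mulVec _ X, hx, mulVec_zero, add_zero, ← hX]
  simp only [mulVec_mulVec, Matrix.mul_assoc]

theorem isHermitian_sub_mul_add_mul (hA : A.IsHermitian) {X : Matrix (Fin m) (Fin m) ℂ}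
    (hX : X.IsHermitian) : (A - (B * X + X * Bᴴ)).IsHermitian := by
  simp [IsHermitian, conjTranspose_mul, hA.eq, hX.eq, add_comm]

theorem exists_loewnerGE_iff (hA : A.IsHermitian) (hC : C.IsHermitian)
    (hcons : ∃ X : Matrix (Fin m) (Fin m) ℂ, B * X * Bᴴ = C) :
    (∃ X : Matrix (Fin m) (Fin m) ℂ, X.IsHermitian ∧
        LoewnerGE A (B * X + X * Bᴴ) ∧ B * X * Bᴴ = C) ↔
      (∀ x, Bᴴ *ᵥ x = 0 → 0 ≤ (star x ⬝ᵥ (A *ᵥ x)).re) ∧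
      (∀ x, 0 ≤ (star x ⬝ᵥ (matM3 A B C *ᵥ x)).re) ∧
      ∀ x, Bᴴ *ᵥ (Bᴴ *ᵥ x) = 0 → star (Bᴴ *ᵥ x) ⬝ᵥ (A *ᵥ (Bᴴ *ᵥ x)) = 0 →
        A *ᵥ (Bᴴ *ᵥ x) = C *ᵥ x := by
  constructor
  · rintro ⟨X, hX, hge, hXC⟩
    refine ⟨fun x hx => ?_, fun x => ?_, fun x hx h0 => ?_⟩
    · rw [← dotProduct_sub_mulVec_of_mem_ker A X hx, ← hge.1.dotProduct_mulVec_nonneg_iff]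
      exact hge.dotProduct_mulVec_nonneg x
    · rw [dotProduct_matM3_mulVec hXC, ← hge.1.dotProduct_mulVec_nonneg_iff]
      exact hge.dotProduct_mulVec_nonneg _
    · rw [← dotProduct_sub_mulVec_of_mem_ker A X hx] at h0
      have := (hge.dotProduct_mulVec_zero_iff _).mp h0
      rwa [sub_mulVec_mulVec_eq hXC hx, sub_eq_zero] at this
  · rintro ⟨h1, h2, h3⟩
    obtain ⟨X, hX, hXC⟩ := exists_isHermitian_of_mul_mul_conjTranspose_eq hC hcons
    have hG : (A - (B * X + X * Bᴴ)).IsHermitian := isHermitian_sub_mul_add_mul hA hX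
    obtain ⟨Y, hY, hY0, hYG⟩ := hG.exists_posSemidef_sub B
      (fun x hx => by
        rw [hG.dotProduct_mulVec_nonneg_iff, dotProduct_sub_mulVec_of_mem_ker A X hx]
        exact h1 x hx)
      (fun x => by
        rw [hG.dotProduct_mulVec_nonneg_iff, ← dotProduct_matM3_mulVec hXC]
        exact h2 x)
      (fun x hx h0 => by
        rw [dotProduct_sub_mulVec_of_mem_ker A X hx] at h0
        rw [sub_mulVec_mulVec_eq hXC hx, h3 x hx h0, sub_self])
    refine ⟨X + Y, hX.add hY, ?_, ?_⟩
    · unfold LoewnerGE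
      convert hYG using 1
      noncomm_ring
    · rw [Matrix.mul_add, Matrix.add_mul, hXC, hY0, add_zero]

/-- Strict positivity on each of the two subspaces leaves a uniform margin, so the semidefinite
criterion applies to `A - η`; a solution for `A - η` is a strict solution for `A`. -/
theorem exists_loewnerGT_iff (hA : A.IsHermitian) (hC : C.IsHermitian)
    (hcons : ∃ X : Matrix (Fin m) (Fin m) ℂ, B * X * Bᴴ = C) :
    (∃ X : Matrix (Fin m) (Fin m) ℂ, X.IsHermitian ∧
        LoewnerGT A (B * X + X * Bᴴ) ∧ B * X * Bᴴ = C) ↔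
      (∀ x, x ≠ 0 → Bᴴ *ᵥ x = 0 → 0 < (star x ⬝ᵥ (A *ᵥ x)).re) ∧
      ∀ x, Bᴴ *ᵥ x ≠ 0 → 0 < (star x ⬝ᵥ (matM3 A B C *ᵥ x)).re := by
  constructor
  · rintro ⟨X, hX, hgt, hXC⟩
    refine ⟨fun x hx0 hx => ?_, fun x hx => ?_⟩
    · rw [← dotProduct_sub_mulVec_of_mem_ker A X hx, ← hgt.1.dotProduct_mulVec_pos_iff]
      exact hgt.dotProduct_mulVec_pos hx0
    · rw [dotProduct_matM3_mulVec hXC, ← hgt.1.dotProduct_mulVec_pos_iff]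
      exact hgt.dotProduct_mulVec_pos hx
  · rintro ⟨h1, h2⟩
    obtain ⟨X, hX, hXC⟩ := exists_isHermitian_of_mul_mul_conjTranspose_eq hC hcons
    obtain ⟨ε, hε, hεA⟩ := exists_pos_mul_le_of_pos_on A (LinearMap.ker Bᴴ.mulVecLin)
      fun x hx hx0 => h1 x hx0 hx
    obtain ⟨δ, hδ, hδG⟩ := exists_pos_mul_le_of_pos_on (A - (B * X + X * Bᴴ))
      (LinearMap.range Bᴴ.mulVecLin) (by
        rintro _ ⟨x, rfl⟩ hx
        rw [mulVecLin_apply, ← dotProduct_matM3_mulVec hXC]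
        exact h2 x hx)
    have hp : ∀ x : Fin m → ℂ, 0 ≤ (star x ⬝ᵥ x).re := fun x =>
      (Complex.le_def.mp (dotProduct_star_self_nonneg x)).1
    set η : ℝ := min ε δ / 2 with hη
    have hη0 : 0 < η := by positivity
    have hηε : η < ε := by have := min_le_left ε δ; linarith
    have hηδ : η < δ := by have := min_le_right ε δ; linarith
    have hA' : (A - (η : ℂ) • (1 : Matrix (Fin m) (Fin m) ℂ)).IsHermitian := by
      simp [IsHermitian, hA.eq]
    have hsub : ∀ (G : Matrix (Fin m) (Fin m) ℂ) (x : Fin m → ℂ),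
        (star x ⬝ᵥ ((G - (η : ℂ) • (1 : Matrix (Fin m) (Fin m) ℂ)) *ᵥ x)).re =
          (star x ⬝ᵥ (G *ᵥ x)).re - η * (star x ⬝ᵥ x).re := by
      intro G x
      rw [sub_mulVec, smul_mulVec, one_mulVec, dotProduct_sub, dotProduct_smul, Complex.sub_re,
        smul_eq_mul, Complex.re_ofReal_mul]
    have hcore := (exists_loewnerGE_iff hA' hC hcons).mpr ⟨fun x hx => ?_, fun x => ?_,
      fun x hx h0 => ?_⟩
    · obtain ⟨Y, hY, hge, hYC⟩ := hcore
      refine ⟨Y, hY, ?_, hYC⟩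
      have hpd : ((η : ℂ) • (1 : Matrix (Fin m) (Fin m) ℂ)).PosDef :=
        PosDef.one.smul (by exact_mod_cast hη0)
      unfold LoewnerGE at hge
      unfold LoewnerGT
      convert hpd.add_posSemidef hge using 1
      abel
    · rw [hsub]
      nlinarith [hεA x hx, mul_le_mul_of_nonneg_right hηε.le (hp x)]
    · rw [dotProduct_matM3_mulVec hXC, sub_right_comm, hsub]
      nlinarith [hδG (Bᴴ *ᵥ x) ⟨x, rfl⟩, mul_le_mul_of_nonneg_right hηδ.le (hp (Bᴴ *ᵥ x))]
    -- The null-vector condition is vacuous: since `η < ε`, the form of `A - η` is definite on `ker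
    -- Bᴴ`, hence `Bᴴ x = 0` and both sides vanish.
    · have h := hsub A (Bᴴ *ᵥ x)
      rw [h0, Complex.zero_re] at h
      have hk : Bᴴ *ᵥ x = 0 := by
        by_contra hne
        have hpos : 0 < (star (Bᴴ *ᵥ x) ⬝ᵥ (Bᴴ *ᵥ x)).re :=
          (Complex.lt_def.mp (dotProduct_star_self_pos_iff.mpr hne)).1
        nlinarith [hεA (Bᴴ *ᵥ x) hx, mul_lt_mul_of_pos_right hηε hpos]
      rw [← hXC, ← mulVec_mulVec, hk, mulVec_zero, mulVec_zero]

end Equation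

/-! ### Translation into ranks and inertias. -/

section Rank

variable {m : ℕ} {A B C : Matrix (Fin m) (Fin m) ℂ}

theorem rank_fromCols_add_finrank (P Q : Matrix (Fin m) (Fin m) ℂ) :
    (fromCols P Q).rank +
      Module.finrank ℂ ↥(LinearMap.ker Pᴴ.mulVecLin ⊓ LinearMap.ker Qᴴ.mulVecLin) = m := by
  have h : LinearMap.ker (fromCols P Q)ᴴ.mulVecLin =
      LinearMap.ker Pᴴ.mulVecLin ⊓ LinearMap.ker Qᴴ.mulVecLin := by
    ext x
    simp [conjTranspose_fromCols_eq_fromRows_conjTranspose, fromRows_mulVec, funext_iff]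
  rw [← rank_conjTranspose, ← h, rank, LinearMap.finrank_range_add_finrank_ker,
    Module.finrank_fintype_fun_eq_card, Fintype.card_fin]

theorem blockM2_conjTranspose_mulVec (hA : A.IsHermitian) (x y : Fin m → ℂ) :
    (blockM2 A B)ᴴ *ᵥ Sum.elim x y =
      Sum.elim (A *ᵥ (Bᴴ *ᵥ x) + B *ᵥ y) (Bᴴ *ᵥ (Bᴴ *ᵥ x)) := by
  rw [blockM2, fromBlocks_conjTranspose, fromBlocks_mulVec, conjTranspose_mul, hA.eq, pow_two,
    conjTranspose_mul]
  simp [mulVec_mulVec]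

/-- Project the kernel of `M₂ᴴ` to its first component: the image is the displayed intersection and
the fibre over `0` is `ker B`. -/
theorem rank_blockM2_add_finrank (hA : A.IsHermitian) (B : Matrix (Fin m) (Fin m) ℂ) :
    (blockM2 A B).rank + Module.finrank ℂ ↥(LinearMap.ker (B ^ 2)ᴴ.mulVecLin ⊓
      (LinearMap.range B.mulVecLin).comap (A * Bᴴ).mulVecLin) = m + B.rank := by
  set K := LinearMap.ker (blockM2 A B)ᴴ.mulVecLin with hK
  let φ : K →ₗ[ℂ] (Fin m → ℂ) := LinearMap.funLeft ℂ ℂ Sum.inl ∘ₗ K.subtype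
  have hmem : ∀ x y, Sum.elim x y ∈ K ↔
      A *ᵥ (Bᴴ *ᵥ x) + B *ᵥ y = 0 ∧ Bᴴ *ᵥ (Bᴴ *ᵥ x) = 0 := by
    intro x y
    rw [hK, LinearMap.mem_ker, mulVecLin_apply, blockM2_conjTranspose_mulVec hA,
      ← Sum.elim_zero_zero, Sum.elim_eq_iff]
  have hrange : LinearMap.range φ = LinearMap.ker (B ^ 2)ᴴ.mulVecLin ⊓
      (LinearMap.range B.mulVecLin).comap (A * Bᴴ).mulVecLin := by
    ext x
    simp only [LinearMap.mem_range, Submodule.mem_inf, LinearMap.mem_ker, Submodule.mem_comap,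
      mulVecLin_apply, pow_two, conjTranspose_mul, ← mulVec_mulVec]
    constructor
    · rintro ⟨⟨z, hz⟩, rfl⟩
      rw [← Sum.elim_comp_inl_inr z, hmem] at hz
      exact ⟨hz.2, -(z ∘ Sum.inr), by rw [mulVec_neg, neg_eq_iff_add_eq_zero, add_comm]; exact hz.1⟩
    · rintro ⟨hx, y, hy⟩
      refine ⟨⟨Sum.elim x (-y), (hmem _ _).mpr ⟨?_, hx⟩⟩, rfl⟩
      rw [mulVec_neg, hy, add_neg_cancel]
  have hker : Module.finrank ℂ (LinearMap.ker φ) = Module.finrank ℂ (LinearMap.ker B.mulVecLin) := by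
    refine LinearEquiv.finrank_eq
      { toFun := fun z => ⟨z.1.1 ∘ Sum.inr, ?_⟩
        invFun := fun y => ⟨⟨Sum.elim 0 y, (hmem _ _).mpr ?_⟩, ?_⟩
        map_add' := fun _ _ => rfl
        map_smul' := fun _ _ => rfl
        left_inv := ?_
        right_inv := fun y => rfl }
    · obtain ⟨⟨z, hz⟩, h0⟩ := z
      have h0' : z ∘ Sum.inl = 0 := h0
      rw [← Sum.elim_comp_inl_inr z, hmem, h0'] at hz
      simpa using hz.1
    · have hy : B *ᵥ (y : Fin m → ℂ) = 0 := y.2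
      simp [hy]
    · rfl
    · rintro ⟨⟨z, hz⟩, h0⟩
      have h0' : z ∘ Sum.inl = 0 := h0
      refine Subtype.ext (Subtype.ext ?_)
      change Sum.elim (0 : Fin m → ℂ) (z ∘ Sum.inr) = z
      rw [← h0', Sum.elim_comp_inl_inr]
  have h1 := φ.finrank_range_add_finrank_ker
  have h2 := (blockM2 A B)ᴴ.mulVecLin.finrank_range_add_finrank_ker
  have h3 := B.mulVecLin.finrank_range_add_finrank_ker
  rw [hrange, hker] at h1
  rw [← hK] at h2
  rw [Module.finrank_fintype_fun_eq_card] at h2 h3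
  rw [Fintype.card_sum, Fintype.card_fin] at h2
  rw [Fintype.card_fin] at h3
  rw [← rank_conjTranspose]
  unfold rank
  omega

theorem mem_ker_sq_inf_ker_iff (hA : A.IsHermitian) (hC : C.IsHermitian) {x : Fin m → ℂ} :
    x ∈ LinearMap.ker (B ^ 2)ᴴ.mulVecLin ⊓ LinearMap.ker (C - B * A)ᴴ.mulVecLin ↔
      Bᴴ *ᵥ (Bᴴ *ᵥ x) = 0 ∧ A *ᵥ (Bᴴ *ᵥ x) = C *ᵥ x := by
  simp only [Submodule.mem_inf, LinearMap.mem_ker, mulVecLin_apply, pow_two, conjTranspose_mul,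
    conjTranspose_sub, sub_mulVec, hA.eq, hC.eq, ← mulVec_mulVec, sub_eq_zero, eq_comm]

/-- The left side equals `(i₋(M₁) - r(B)) + (dim D - dim K)`, where `K` is given by `Bᴴ Bᴴ x = 0`,
`A Bᴴ x = C x`, and `D` by `Bᴴ Bᴴ x = 0`, `A Bᴴ x ∈ range B`. Consistency gives `C x ∈ range B`, so
`K ≤ D` and both summands are nonnegative. -/
theorem rank_add_negInertia_blockM1_iff (hA : A.IsHermitian) (hC : C.IsHermitian)
    (hcons : ∃ X : Matrix (Fin m) (Fin m) ℂ, B * X * Bᴴ = C) :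
    ((fromCols (B ^ 2) (C - B * A)).rank : ℤ) + negInertia (blockM1_isHermitian hA B)
        - (blockM2 A B).rank = 0 ↔
      (∀ x, Bᴴ *ᵥ x = 0 → 0 ≤ (star x ⬝ᵥ (A *ᵥ x)).re) ∧
      ∀ x y, Bᴴ *ᵥ (Bᴴ *ᵥ x) = 0 → A *ᵥ (Bᴴ *ᵥ x) = B *ᵥ y → A *ᵥ (Bᴴ *ᵥ x) = C *ᵥ x := by
  obtain ⟨X, hX⟩ := hcons
  have h1 := rank_fromCols_add_finrank (B ^ 2) (C - B * A)
  have h2 := rank_blockM2_add_finrank hA B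
  have hb := rank_le_negInertia_blockM1 hA B
  have hle : LinearMap.ker (B ^ 2)ᴴ.mulVecLin ⊓ LinearMap.ker (C - B * A)ᴴ.mulVecLin ≤
      LinearMap.ker (B ^ 2)ᴴ.mulVecLin ⊓
        (LinearMap.range B.mulVecLin).comap (A * Bᴴ).mulVecLin := by
    intro x hx
    refine ⟨hx.1, X *ᵥ (Bᴴ *ᵥ x), ?_⟩
    rw [mulVecLin_apply, mulVecLin_apply, ← mulVec_mulVec x A,
      ((mem_ker_sq_inf_ker_iff hA hC).mp hx).2, ← hX, mulVec_mulVec, mulVec_mulVec]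
  have hmono := Submodule.finrank_mono hle
  rw [← negInertia_blockM1_le_rank_iff hA B]
  constructor
  · intro h
    refine ⟨by omega, fun x y hx hxy => ?_⟩
    have heq := Submodule.eq_of_le_of_finrank_eq hle (by omega)
    refine ((mem_ker_sq_inf_ker_iff (B := B) hA hC).mp ?_).2
    rw [heq]
    refine ⟨?_, y, ?_⟩
    · simpa [pow_two, conjTranspose_mul, ← mulVec_mulVec] using hx
    · rw [mulVecLin_apply, mulVecLin_apply, ← mulVec_mulVec x A, hxy]
  · rintro ⟨h, h'⟩
    have hge : LinearMap.ker (B ^ 2)ᴴ.mulVecLin ⊓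
        (LinearMap.range B.mulVecLin).comap (A * Bᴴ).mulVecLin ≤
        LinearMap.ker (B ^ 2)ᴴ.mulVecLin ⊓ LinearMap.ker (C - B * A)ᴴ.mulVecLin := by
      rintro x ⟨hx, y, hy⟩
      have hx' : Bᴴ *ᵥ (Bᴴ *ᵥ x) = 0 := by
        simpa [pow_two, conjTranspose_mul, ← mulVec_mulVec] using hx
      rw [mem_ker_sq_inf_ker_iff hA hC]
      refine ⟨hx', h' x y hx' ?_⟩
      rw [mulVecLin_apply, mulVecLin_apply, ← mulVec_mulVec x A] at hy
      exact hy.symm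
    have := Submodule.finrank_mono hge
    omega

/-- The same count: the left side is `i₋(M₃)` plus the difference of dimensions of two nested
kernels, the larger one requiring `A Bᴴ x = C x` only after multiplication by `B`. -/
theorem rank_add_negInertia_matM3_iff (hA : A.IsHermitian) (hC : C.IsHermitian) :
    ((fromCols (B ^ 2) (C - B * A)).rank : ℤ) + negInertia (matM3_isHermitian hA hC B)
        - (fromCols (B ^ 2) (C * Bᴴ - B * A * Bᴴ)).rank = 0 ↔
      (∀ x, 0 ≤ (star x ⬝ᵥ (matM3 A B C *ᵥ x)).re) ∧
      ∀ x, Bᴴ *ᵥ (Bᴴ *ᵥ x) = 0 → B *ᵥ (A *ᵥ (Bᴴ *ᵥ x)) = B *ᵥ (C *ᵥ x) →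
        A *ᵥ (Bᴴ *ᵥ x) = C *ᵥ x := by
  have h1 := rank_fromCols_add_finrank (B ^ 2) (C - B * A)
  have h2 := rank_fromCols_add_finrank (B ^ 2) (C * Bᴴ - B * A * Bᴴ)
  have hmem : ∀ x, x ∈ LinearMap.ker (B ^ 2)ᴴ.mulVecLin ⊓
      LinearMap.ker (C * Bᴴ - B * A * Bᴴ)ᴴ.mulVecLin ↔
      Bᴴ *ᵥ (Bᴴ *ᵥ x) = 0 ∧ B *ᵥ (A *ᵥ (Bᴴ *ᵥ x)) = B *ᵥ (C *ᵥ x) := by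
    intro x
    simp only [Submodule.mem_inf, LinearMap.mem_ker, mulVecLin_apply, pow_two, conjTranspose_mul,
      conjTranspose_sub, sub_mulVec, hA.eq, hC.eq, ← mulVec_mulVec, sub_eq_zero,
      conjTranspose_conjTranspose, eq_comm]
  have hle : LinearMap.ker (B ^ 2)ᴴ.mulVecLin ⊓ LinearMap.ker (C - B * A)ᴴ.mulVecLin ≤
      LinearMap.ker (B ^ 2)ᴴ.mulVecLin ⊓ LinearMap.ker (C * Bᴴ - B * A * Bᴴ)ᴴ.mulVecLin := by
    intro x hx
    rw [mem_ker_sq_inf_ker_iff hA hC] at hx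
    exact (hmem x).mpr ⟨hx.1, by rw [hx.2]⟩
  have hmono := Submodule.finrank_mono hle
  rw [← negInertia_eq_zero_iff (matM3_isHermitian hA hC B)]
  constructor
  · intro h
    refine ⟨by omega, fun x hx hxy => ?_⟩
    have heq := Submodule.eq_of_le_of_finrank_eq hle (by omega)
    refine ((mem_ker_sq_inf_ker_iff (B := B) hA hC).mp ?_).2
    rw [heq]
    exact (hmem x).mpr ⟨hx, hxy⟩
  · rintro ⟨h, h'⟩
    have hge : LinearMap.ker (B ^ 2)ᴴ.mulVecLin ⊓
        LinearMap.ker (C * Bᴴ - B * A * Bᴴ)ᴴ.mulVecLin ≤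
        LinearMap.ker (B ^ 2)ᴴ.mulVecLin ⊓ LinearMap.ker (C - B * A)ᴴ.mulVecLin := by
      intro x hx
      rw [hmem] at hx
      rw [mem_ker_sq_inf_ker_iff hA hC]
      exact ⟨hx.1, h' x hx.1 hx.2⟩
    have := Submodule.finrank_mono hge
    omega

/-- A vector orthogonal to the kernel of `Bᴴ` is in the range of `B`. -/
theorem exists_mulVec_eq_of_forall_ker (B : Matrix (Fin m) (Fin m) ℂ) (v : Fin m → ℂ)
    (h : ∀ x, Bᴴ *ᵥ x = 0 → star x ⬝ᵥ v = 0) : ∃ y, v = B *ᵥ y := by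
  obtain ⟨R, hR⟩ := B.exists_conjTranspose_mul_self_mul_eq
  refine ⟨R *ᵥ v, ?_⟩
  have hker : Bᴴ *ᵥ (v - B *ᵥ (R *ᵥ v)) = 0 := by
    rw [mulVec_sub, mulVec_mulVec, mulVec_mulVec, hR, sub_self]
  have h1 := h _ hker
  have h2 : star (v - B *ᵥ (R *ᵥ v)) ⬝ᵥ (B *ᵥ (R *ᵥ v)) = 0 := by
    rw [dotProduct_mulVec, show star (v - B *ᵥ (R *ᵥ v)) ᵥ* B = star (Bᴴ *ᵥ (v - B *ᵥ (R *ᵥ v))) by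
      rw [star_mulVec, conjTranspose_conjTranspose], hker, star_zero, zero_dotProduct]
  have h3 : star (v - B *ᵥ (R *ᵥ v)) ⬝ᵥ (v - B *ᵥ (R *ᵥ v)) = 0 := by
    rw [dotProduct_sub, h1, h2, sub_zero]
  exact sub_eq_zero.mp (dotProduct_star_self_eq_zero.mp h3)

/-- The compression of `A` to `ker Bᴴ` is positive semidefinite, so it kills its null vector `k`;
hence `A k` is orthogonal to `ker Bᴴ`. -/
theorem IsHermitian.mulVec_mem_range_of_dotProduct_eq_zero (hA : A.IsHermitian)
    (hU : ∀ x, Bᴴ *ᵥ x = 0 → 0 ≤ (star x ⬝ᵥ (A *ᵥ x)).re) {k : Fin m → ℂ} (hk : Bᴴ *ᵥ k = 0)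
    (h0 : star k ⬝ᵥ (A *ᵥ k) = 0) : ∃ y, A *ᵥ k = B *ᵥ y := by
  refine exists_mulVec_eq_of_forall_ker B _ fun x hx => ?_
  obtain ⟨P, hP⟩ := B.exists_conjTranspose_mul_self_mul_eq
  set F : Matrix (Fin m) (Fin m) ℂ := 1 - B * P with hF
  have hBF : Bᴴ * F = 0 := by
    rw [hF, Matrix.mul_sub, Matrix.mul_one, ← Matrix.mul_assoc, hP, sub_self]
  have hF1 : ∀ x, Bᴴ *ᵥ x = 0 → F *ᵥ x = x := fun x hx => by
    have h : B *ᵥ (P *ᵥ x) = 0 := by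
      rw [← conjTranspose_mul_self_mulVec_eq_zero, mulVec_mulVec, hP, hx]
    rw [hF, sub_mulVec, one_mulVec, ← mulVec_mulVec, h, sub_zero]
  have hpsd := hA.posSemidef_conjTranspose_mul_mul F fun x => by
    rw [hA.dotProduct_mulVec_nonneg_iff]
    exact hU _ (by rw [mulVec_mulVec, hBF, zero_mulVec])
  have hval : ∀ x y, star x ⬝ᵥ ((Fᴴ * A * F) *ᵥ y) = star (F *ᵥ x) ⬝ᵥ (A *ᵥ (F *ᵥ y)) :=
    fun x y => by rw [star_mulVec, ← dotProduct_mulVec, mulVec_mulVec, mulVec_mulVec]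
  have hzero := (hpsd.dotProduct_mulVec_zero_iff k).mp (by rw [hval, hF1 k hk, h0])
  have h := hval x k
  rw [hzero, dotProduct_zero, hF1 x hx, hF1 k hk] at h
  exact h.symm

/-- When `A` is nonnegative on `ker Bᴴ`, a vector `Bᴴ x` of that kernel is null for `A` exactly when
`A Bᴴ x ∈ range B`. This matches the null-vector condition with the dimension equality in the first
rank condition. -/
theorem loewnerGE_iff_rank (hA : A.IsHermitian) (hC : C.IsHermitian)
    (hcons : ∃ X : Matrix (Fin m) (Fin m) ℂ, B * X * Bᴴ = C) :
    (∃ X : Matrix (Fin m) (Fin m) ℂ, X.IsHermitian ∧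
        LoewnerGE A (B * X + X * Bᴴ) ∧ B * X * Bᴴ = C) ↔
      (((fromCols (B ^ 2) (C - B * A)).rank : ℤ)
          + negInertia (blockM1_isHermitian hA B) - (blockM2 A B).rank = 0 ∧
        ((fromCols (B ^ 2) (C - B * A)).rank : ℤ)
          + negInertia (matM3_isHermitian hA hC B)
          - (fromCols (B ^ 2) (C * Bᴴ - B * A * Bᴴ)).rank = 0) := by
  rw [exists_loewnerGE_iff hA hC hcons, rank_add_negInertia_blockM1_iff hA hC hcons,
    rank_add_negInertia_matM3_iff hA hC]
  have hBk : ∀ x y, Bᴴ *ᵥ x = 0 → star x ⬝ᵥ (B *ᵥ y) = 0 := fun x y hx => by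
    rw [dotProduct_mulVec, ← conjTranspose_conjTranspose B, ← star_mulVec, hx, star_zero,
      zero_dotProduct]
  constructor
  · rintro ⟨h1, h2, h3⟩
    refine ⟨⟨h1, fun x y hx hxy => h3 x hx ?_⟩, h2, fun x hx hxy => h3 x hx ?_⟩
    · rw [hxy, hBk _ _ hx]
    -- Here `⟨Bᴴ x, A Bᴴ x⟩ = ⟨x, B C x⟩ = ⟨Bᴴ Bᴴ x, X Bᴴ x⟩ = 0`, so the second dimension equality
    -- also follows from the null-vector condition.
    · obtain ⟨X, hX⟩ := hcons
      rw [star_mulVec, conjTranspose_conjTranspose, ← dotProduct_mulVec, hxy, ← hX,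
        dotProduct_mulVec, ← mulVec_mulVec, ← mulVec_mulVec]
      nth_rewrite 1 [← conjTranspose_conjTranspose B]
      rw [← star_mulVec, hBk _ _ hx]
  · rintro ⟨⟨h1, h3⟩, h2, -⟩
    refine ⟨h1, h2, fun x hx h0 => ?_⟩
    obtain ⟨y, hy⟩ := hA.mulVec_mem_range_of_dotProduct_eq_zero h1 hx h0
    exact h3 x y hx hy

theorem loewnerGT_iff_inertia (hA : A.IsHermitian) (hC : C.IsHermitian)
    (hcons : ∃ X : Matrix (Fin m) (Fin m) ℂ, B * X * Bᴴ = C) :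
    (∃ X : Matrix (Fin m) (Fin m) ℂ, X.IsHermitian ∧
        LoewnerGT A (B * X + X * Bᴴ) ∧ B * X * Bᴴ = C) ↔
      (m ≤ posInertia (blockM1_isHermitian hA B) ∧
        posInertia (matM3_isHermitian hA hC B) = B.rank) := by
  have hM1 : blockM1 (-A) (-B) = -blockM1 A B := by
    simp [blockM1, fromBlocks_neg]
  have h1 : posInertia (blockM1_isHermitian hA B) =
      negInertia (blockM1_isHermitian hA.neg (-B)) := by
    rw [← negInertia_neg (blockM1_isHermitian hA B) (blockM1_isHermitian hA B).neg]
    simp only [hM1]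
  have hker : ∀ x, Bᴴ *ᵥ x = 0 → (-matM3 A B C) *ᵥ x = 0 := by
    intro x hx
    obtain ⟨X, hX⟩ := hcons
    rw [matM3_eq hX, neg_mulVec, ← mulVec_mulVec, hx, mulVec_zero, neg_zero]
  rw [exists_loewnerGT_iff hA hC hcons, h1, le_negInertia_blockM1_iff hA.neg,
    ← negInertia_neg _ (matM3_isHermitian hA hC B).neg, negInertia_eq_rank_iff _ B hker]
  simp only [conjTranspose_neg, neg_mulVec, neg_eq_zero, dotProduct_neg, Complex.neg_re,
    neg_lt_zero]

theorem loewnerGE_swap (P Q : Matrix (Fin m) (Fin m) ℂ) : LoewnerGE P Q ↔ LoewnerGE (-Q) (-P) := by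
  unfold LoewnerGE
  rw [neg_sub_neg]

theorem loewnerGT_swap (P Q : Matrix (Fin m) (Fin m) ℂ) : LoewnerGT P Q ↔ LoewnerGT (-Q) (-P) := by
  unfold LoewnerGT
  rw [neg_sub_neg]

theorem rank_neg (P : Matrix (Fin m) (Fin m) ℂ) : (-P).rank = P.rank := by
  have h := rank_mul_eq_right_of_isUnit_det (-1 : Matrix (Fin m) (Fin m) ℂ) P (by simp [det_neg])
  rwa [neg_one_mul] at h

end Rank

end Matrix

/-! ### The four criteria and the sign change. -/

theorem mainTheorem8 (m : ℕ) (A B C : Matrix (Fin m) (Fin m) ℂ)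
    (hA : A.IsHermitian) (hC : C.IsHermitian)
    (hcons : ∃ X : Matrix (Fin m) (Fin m) ℂ, B * X * Bᴴ = C) :
    -- (a)
    ((∃ X : Matrix (Fin m) (Fin m) ℂ, X.IsHermitian ∧
        LoewnerGE A (B * X + X * Bᴴ) ∧ B * X * Bᴴ = C) ↔
      (((Matrix.fromCols (B ^ 2) (C - B * A)).rank : ℤ)
          + negInertia (blockM1_isHermitian hA B) - (blockM2 A B).rank = 0 ∧
        ((Matrix.fromCols (B ^ 2) (C - B * A)).rank : ℤ)
          + negInertia (matM3_isHermitian hA hC B)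
          - (Matrix.fromCols (B ^ 2) (C * Bᴴ - B * A * Bᴴ)).rank = 0)) ∧
    -- (b)
    ((∃ X : Matrix (Fin m) (Fin m) ℂ, X.IsHermitian ∧
        LoewnerGT A (B * X + X * Bᴴ) ∧ B * X * Bᴴ = C) ↔
      (m ≤ posInertia (blockM1_isHermitian hA B) ∧
        posInertia (matM3_isHermitian hA hC B) = B.rank)) ∧
    -- (c)
    ((∃ X : Matrix (Fin m) (Fin m) ℂ, X.IsHermitian ∧
        LoewnerGE (B * X + X * Bᴴ) A ∧ B * X * Bᴴ = C) ↔
      (((Matrix.fromCols (B ^ 2) (C - B * A)).rank : ℤ)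
          + posInertia (blockM1_isHermitian hA B) - (blockM2 A B).rank = 0 ∧
        ((Matrix.fromCols (B ^ 2) (C - B * A)).rank : ℤ)
          + posInertia (matM3_isHermitian hA hC B)
          - (Matrix.fromCols (B ^ 2) (C * Bᴴ - B * A * Bᴴ)).rank = 0)) ∧
    -- (d)
    ((∃ X : Matrix (Fin m) (Fin m) ℂ, X.IsHermitian ∧
        LoewnerGT (B * X + X * Bᴴ) A ∧ B * X * Bᴴ = C) ↔
      (m ≤ negInertia (blockM1_isHermitian hA B) ∧
        negInertia (matM3_isHermitian hA hC B) = B.rank)) := by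
  -- The substitution `(A, B, C) ↦ (-A, -B, C)` fixes `B X Bᴴ`, negates `B X + X Bᴴ`, `M₁` and `M₃`,
  -- and preserves all the ranks. It exchanges `i₊` with `i₋` and reverses the order relations,
  -- turning (a) and (b) into (c) and (d).
  have hconsN : ∃ X : Matrix (Fin m) (Fin m) ℂ, -B * X * (-B)ᴴ = C := by simpa using hcons
  have hX : ∀ X : Matrix (Fin m) (Fin m) ℂ, -B * X + X * (-B)ᴴ = -(B * X + X * Bᴴ) := fun X => by
    rw [Matrix.conjTranspose_neg, Matrix.neg_mul, Matrix.mul_neg, neg_add]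
  have hXC : ∀ X : Matrix (Fin m) (Fin m) ℂ, -B * X * (-B)ᴴ = B * X * Bᴴ := fun X => by simp
  have hM1 : blockM1 (-A) (-B) = -blockM1 A B := by
    simp [blockM1, Matrix.fromBlocks_neg]
  have hM3 : matM3 (-A) (-B) C = -matM3 A B C := by
    simp [matM3]
    abel
  have hM2 : blockM2 (-A) (-B) =
      Matrix.fromBlocks 1 0 0 (-1 : Matrix (Fin m) (Fin m) ℂ) * blockM2 A B := by
    simp [blockM2, Matrix.fromBlocks_multiply]
  have hr2 : (blockM2 (-A) (-B)).rank = (blockM2 A B).rank := by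
    rw [hM2]
    refine Matrix.rank_mul_eq_right_of_isUnit_det _ _ ?_
    rw [Matrix.det_fromBlocks_zero₂₁, Matrix.det_neg]
    simp
  have hr3 : (Matrix.fromCols ((-B) ^ 2) (C * (-B)ᴴ - -B * -A * (-B)ᴴ)).rank =
      (Matrix.fromCols (B ^ 2) (C * Bᴴ - B * A * Bᴴ)).rank := by
    have h1 := Matrix.rank_fromCols_add_finrank ((-B) ^ 2) (C * (-B)ᴴ - -B * -A * (-B)ᴴ)
    have h2 := Matrix.rank_fromCols_add_finrank (B ^ 2) (C * Bᴴ - B * A * Bᴴ)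
    have h3 : C * (-B)ᴴ - -B * -A * (-B)ᴴ = -(C * Bᴴ - B * A * Bᴴ) := by
      simp only [Matrix.conjTranspose_neg, Matrix.mul_neg, Matrix.neg_mul, neg_neg]
      abel
    have h4 : LinearMap.ker ((-(C * Bᴴ - B * A * Bᴴ))ᴴ).mulVecLin =
        LinearMap.ker ((C * Bᴴ - B * A * Bᴴ)ᴴ).mulVecLin := by
      ext x
      rw [Matrix.conjTranspose_neg, LinearMap.mem_ker, LinearMap.mem_ker,
        Matrix.mulVecLin_apply, Matrix.mulVecLin_apply, Matrix.neg_mulVec, neg_eq_zero]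
    rw [h3, neg_sq, h4] at h1
    rw [h3, neg_sq]
    omega
  have hpos1 : negInertia (blockM1_isHermitian hA.neg (-B)) =
      posInertia (blockM1_isHermitian hA B) := by
    rw [← Matrix.negInertia_neg (blockM1_isHermitian hA B) (blockM1_isHermitian hA B).neg]
    simp only [hM1]
  have hpos3 : negInertia (matM3_isHermitian hA.neg hC (-B)) =
      posInertia (matM3_isHermitian hA hC B) := by
    rw [← Matrix.negInertia_neg _ (matM3_isHermitian hA hC B).neg]
    simp only [hM3]
  have hneg1 : posInertia (blockM1_isHermitian hA.neg (-B)) =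
      negInertia (blockM1_isHermitian hA B) := by
    rw [← Matrix.negInertia_neg _ (blockM1_isHermitian hA.neg (-B)).neg]
    simp only [hM1, neg_neg]
  have hneg3 : posInertia (matM3_isHermitian hA.neg hC (-B)) =
      negInertia (matM3_isHermitian hA hC B) := by
    rw [← Matrix.negInertia_neg _ (matM3_isHermitian hA.neg hC (-B)).neg]
    simp only [hM3, neg_neg]
  refine ⟨Matrix.loewnerGE_iff_rank hA hC hcons, Matrix.loewnerGT_iff_inertia hA hC hcons, ?_, ?_⟩
  · have h := Matrix.loewnerGE_iff_rank hA.neg hC hconsN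
    rw [hr2, hr3, hpos1, hpos3, neg_sq, neg_mul_neg] at h
    simp only [hX, hXC] at h
    simpa only [← Matrix.loewnerGE_swap] using h
  · have h := Matrix.loewnerGT_iff_inertia hA.neg hC hconsN
    rw [hneg1, hneg3, Matrix.rank_neg] at h
    simp only [hX, hXC] at h
    simpa only [← Matrix.loewnerGT_swap] using h
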